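/- Let $\mu>0$, $\eta\ge 0$, $\gamma\ge 6$ and $q=\frac{6\gamma}{5\gamma-6}$. For $1\le r<3$ let $D_0^{1,r}(\mathbb{R}^3)$ be the completion of $C_c^\infty(\mathbb{R}^3)$ under the norm $\|\nabla\varphi\|_{L^r(\mathbb{R}^3)}$, realized as the space of those $f\in L^1_{\mathrm{loc}}(\mathbb{R}^3)$ with weak gradient $\nabla f\in L^r(\mathbb{R}^3;\mathbb{R}^3)$ for which there are $\varphi_n\in C_c^\infty(\mathbb{R}^3)$ with $\varphi_n\to f$ in $L^1_{\mathrm{loc}}(\mathbb{R}^3)$ and $\nabla\varphi_n\to\nabla f$ in $L^r(\mathbb{R}^3;\mathbb{R}^3)$. Let $D_0^{1,2}(\mathbb{R}^3;\mathbb{R}^3)$ be the space of vector fields whose components lie in $D_0^{1,2}(\mathbb{R}^3)$. Put $$\mathbb{S}(\nabla\mathbf{u})=\mu\left(\nabla\mathbf{u}+\nabla^t\mathbf{u}-\tfrac23\,\mathrm{div}\,\mathbf{u}\,\mathbb{I}\right)+\eta\,\mathrm{div}\,\mathbf{u}\,\mathbb{I}.$$ Let $G\in D_0^{1,q}(\mathbb{R}^3)$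 and let $(\rho,\mathbf{u})$ be a weak solution on $\mathbb{R}^3$ of the stationary barotropic Navier–Stokes system $$\mathrm{div}(\rho\mathbf{u})=0,\qquad \mathrm{div}(\rho\mathbf{u}\otimes\mathbf{u})+\nabla p(\rho)-\mathrm{div}\,\mathbb{S}(\nabla\mathbf{u})=\rho\nabla G,\qquad p(\rho)=\rho^\gamma,$$ that is: $\rho:\mathbb{R}^3\to\mathbb{R}$ and $\mathbf{u}:\mathbb{R}^3\to\mathbb{R}^3$ are measurable and $\rho\ge0$ a.e.; $\rho\mathbf{u}\in L^1_{\mathrm{loc}}$ and $\int_{\mathbb{R}^3}\rho\mathbf{u}\cdot\nabla\phi\,dx=0$ for all $\phi\in C_c^\infty(\mathbb{R}^3)$; $\rho,\ \rho|\mathbf{u}|^2,\ \rho^\gamma,\ \rho\nabla G\in L^1_{\mathrm{loc}}$, $\mathbf{u}\in D_0^{1,2}(\mathbb{R}^3;\mathbb{R}^3)$, and $$\int_{\mathbb{R}^3}\left[\rho\mathbf{u}\otimes\mathbf{u}:\nabla\boldsymbol\varphi+\rho^\gamma\,\mathrm{div}\,\boldsymbol\varphi\right]dx=\int_{\mathbb{R}^3}\mathbb{S}(\nabla\mathbf{u}):\nabla\boldsymbol\varphi\,dx-\int_{\mathbb{R}^3}\rho\nabla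 G\cdot\boldsymbol\varphi\,dx$$ for all $\boldsymbol\varphi\in C_c^1(\mathbb{R}^3;\mathbb{R}^3)$. If the total energy is finite, $$\int_{\mathbb{R}^3}\left(\tfrac12\rho|\mathbf{u}|^2+\tfrac{1}{\gamma-1}\rho^\gamma\right)dx<\infty,$$ then $\mathbf{u}=0$ a.e. in $\mathbb{R}^3$. -/

import Mathlib

open MeasureTheory Filter Topology
open scoped ContDiff ENNReal Matrix

noncomputable section

namespace BarotropicNS

/-- Three-dimensional Euclidean space, with Lebesgue measure `volume`. -/
abbrev E3 : Type := EuclideanSpace ℝ (Fin 3)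

/-- `g` is the weak (distributional) gradient of the scalar function `f` on `ℝ³`:
`∫ f ∇φ = - ∫ φ g` for every `φ ∈ C_c^∞(ℝ³)`. -/
structure HasWeakGradient (f : E3 → ℝ) (g : E3 → E3) : Prop where
  locallyIntegrable_fun : LocallyIntegrable f
  locallyIntegrable_grad : LocallyIntegrable g
  integral_eq : ∀ φ : E3 → ℝ, ContDiff ℝ ∞ φ → HasCompactSupport φ →
    ∫ x, f x • gradient φ x = -∫ x, φ x • g x

/-- A weak gradient is unique up to a null set. -/
theorem HasWeakGradient.ae_eq {f : E3 → ℝ} {g h : E3 → E3}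
    (hg : HasWeakGradient f g) (hh : HasWeakGradient f h) : g =ᵐ[volume] h := by
  refine ae_eq_of_integral_contDiff_smul_eq hg.locallyIntegrable_grad
    hh.locallyIntegrable_grad fun φ hφ hc => ?_
  have h1 := hg.integral_eq φ hφ hc
  have h2 := hh.integral_eq φ hφ hc
  exact neg_injective (h1.symm.trans h2)

open Classical in
/-- The weak gradient of `f` (determined up to a null set), and `0` if there is none. -/
def weakGradient (f : E3 → ℝ) : E3 → E3 :=
  if h : ∃ g, HasWeakGradient f g then h.choose else 0

theorem HasWeakGradient.weakGradient {f : E3 → ℝ} {g : E3 → E3} (hg : HasWeakGradient f g) :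
    HasWeakGradient f (weakGradient f) := by
  have h : ∃ g, HasWeakGradient f g := ⟨g, hg⟩
  rw [BarotropicNS.weakGradient, dif_pos h]
  exact h.choose_spec

/-- The homogeneous Sobolev space `D₀^{1,q}(ℝ³)` for `1 ≤ q < 3`, i.e. the completion of
`C_c^∞(ℝ³)` for the norm `‖∇φ‖_{L^q}`, realized as a space of functions: `f` has a weak gradient
in `L^q`, and some sequence of test functions converges to `f` in `L¹_loc` while its gradients
converge to that of `f` in `L^q`. -/
def MemD01 (q : ℝ≥0∞) (f : E3 → ℝ) : Prop :=
  ∃ g : E3 → E3, HasWeakGradient f g ∧ MemLp g q volume ∧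
    ∃ φ : ℕ → E3 → ℝ, (∀ n, ContDiff ℝ ∞ (φ n) ∧ HasCompactSupport (φ n)) ∧
      Tendsto (fun n => eLpNorm (fun x => gradient (φ n) x - g x) q volume) atTop (𝓝 0) ∧
      ∀ K : Set E3, IsCompact K →
        Tendsto (fun n => eLpNorm (fun x => φ n x - f x) 1 (volume.restrict K)) atTop (𝓝 0)

/-- The contraction `A : B = ∑ᵢⱼ Aᵢⱼ Bᵢⱼ`. -/
def contract (A B : Matrix (Fin 3) (Fin 3) ℝ) : ℝ := ∑ i, ∑ j, A i j * B i j

/-- The classical Jacobian matrix, `(∇φ)ᵢⱼ = ∂ⱼφᵢ`, of a differentiable vector field. -/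
def jacobian (φ : E3 → E3) (x : E3) : Matrix (Fin 3) (Fin 3) ℝ :=
  Matrix.of fun i j => gradient (fun y => φ y i) x j

/-- The weak Jacobian matrix, `(∇u)ᵢⱼ = ∂ⱼuᵢ`. -/
def weakJacobian (u : E3 → E3) (x : E3) : Matrix (Fin 3) (Fin 3) ℝ :=
  Matrix.of fun i j => weakGradient (fun y => u y i) x j

/-- Newton's viscous stress `𝕊(A) = μ (A + Aᵀ - (2/3) tr(A) I) + η tr(A) I`. -/
def viscousStress (μ η : ℝ) (A : Matrix (Fin 3) (Fin 3) ℝ) : Matrix (Fin 3) (Fin 3) ℝ :=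
  μ • (A + Aᵀ - ((2 / 3 : ℝ) * A.trace) • (1 : Matrix (Fin 3) (Fin 3) ℝ))
    + (η * A.trace) • (1 : Matrix (Fin 3) (Fin 3) ℝ)

/-- `(ρ, u)` is a weak solution on `ℝ³` of the stationary barotropic Navier--Stokes system
`div (ρu) = 0`, `div (ρ u ⊗ u) + ∇p(ρ) - div 𝕊(∇u) = ρ ∇G`. -/
structure IsWeakSolution (p : ℝ → ℝ) (μ η : ℝ) (G ρ : E3 → ℝ) (u : E3 → E3) : Prop where
  aemeasurable_density : AEMeasurable ρ volume
  aemeasurable_velocity : AEMeasurable u volume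
  density_nonneg : ∀ᵐ x : E3, 0 ≤ ρ x
  locallyIntegrable_momentum : LocallyIntegrable fun x => ρ x • u x
  continuity_eq : ∀ φ : E3 → ℝ, ContDiff ℝ ∞ φ → HasCompactSupport φ →
    ∫ x, inner ℝ (ρ x • u x) (gradient φ x) = 0
  locallyIntegrable_density : LocallyIntegrable ρ
  locallyIntegrable_kinetic : LocallyIntegrable fun x => ρ x * ‖u x‖ ^ 2
  locallyIntegrable_pressure : LocallyIntegrable fun x => p (ρ x)
  locallyIntegrable_force : LocallyIntegrable fun x => ρ x • weakGradient G x
  velocity_mem : ∀ i : Fin 3, MemD01 2 fun x => u x i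
  momentum_eq : ∀ φ : E3 → E3, ContDiff ℝ 1 φ → HasCompactSupport φ →
    ∫ x, (ρ x * contract (Matrix.vecMulVec (u x) (u x)) (jacobian φ x)
        + p (ρ x) * (jacobian φ x).trace)
      = (∫ x, contract (viscousStress μ η (weakJacobian u x)) (jacobian φ x))
        - ∫ x, inner ℝ (ρ x • weakGradient G x) (φ x)

end BarotropicNS

end

/-!
The solution is tested against its own velocity, and every term of the resulting energy identity
other than the dissipation is shown to vanish.

*Integrability.* By the Sobolev inequality `u ∈ L⁶`. The finite energy and the elementary bound
`(rt)³ ≤ r t² + r^γ + t⁶`, which needs `γ ≥ 6`, give `ρu ∈ L³`, so `ρ u ⊗ u ∈ L²`; the exponent `q`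
is the one for which `ρ∇G ∈ L^{6/5}`, the dual of `L⁶`. Testing the momentum equation with
`∇ψ` then bounds `∫ ρ^γ Δψ` by a multiple of `‖Δψ‖_{L²}`. The functions `Δψ` are dense in `L²`,
because `L²` contains no nonzero harmonic function, and so the pressure `ρ^γ` is in `L²`
(`memLp_two_of_gradient`). All fluxes in the momentum equation are therefore in `L²`, the force is
in `L^{6/5}`, and test functions converging to `u` may be replaced by `u` in the limit.

*Terms that do no work.* The continuity equation tested with approximations of `|u|²` and of `G`
removes the convective term and the force (`sum_integral_convection_eq_zero`,
`sum_integral_force_eq_zero`). For the pressure, the density is mollified: the commutator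
`u · ∇ρ_ε` is an average of `ρ` times difference quotients of `u`. Multiplied by `ρ_ε^{γ-1}` and
integrated, it tends to `-∫ ρ^γ div u`, where `ρ ∈ L^{2γ}` and `∇u ∈ L²` are exactly what is needed;
on the other hand the chain rule gives `-γ⁻¹ ∫ ρ_ε^γ div u`. As `γ ≠ 1`, the integral vanishes
(`sum_integral_rpow_mul_eq_zero`, a form of the DiPerna-Lions renormalization).

*Conclusion.* What is left is `∫ 𝕊(∇u) : ∇u = 0`. Since `∫ ∂ⱼuᵢ ∂ᵢuⱼ = ∫ (div u)²`, this integral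
equals `μ ∫ |∇u|² + (μ/3 + η) ∫ (div u)²` (`gradient_ae_eq_zero_of_dissipation`), hence `∇u = 0`,
and `u = 0` by the Sobolev inequality.
-/

noncomputable section

namespace BarotropicNS

/-! ### Partial derivatives and test functions -/

/-- The `i`-th partial derivative of a scalar function on `ℝ³`. -/
def pd (i : Fin 3) (f : E3 → ℝ) (x : E3) : ℝ := fderiv ℝ f x (EuclideanSpace.single i 1)

theorem gradient_apply (f : E3 → ℝ) (x : E3) (i : Fin 3) : gradient f x i = pd i f x := by
  have h : inner ℝ (gradient f x) (EuclideanSpace.single i (1 : ℝ)) = pd i f x := by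
    rw [gradient, InnerProductSpace.toDual_symm_apply, pd]
  rw [← h, EuclideanSpace.inner_single_right]
  simp

theorem fderiv_apply_eq_sum (f : E3 → ℝ) (x h : E3) :
    fderiv ℝ f x h = ∑ j, h j * pd j f x := by
  have hh : h = ∑ j, h j • EuclideanSpace.single j (1 : ℝ) := by
    ext i
    fin_cases i <;> simp [Fin.sum_univ_three]
  conv_lhs => rw [hh]
  simp [map_sum, pd]

/-- Scalar test functions: the smooth compactly supported functions on `ℝ³`. -/
structure IsTest (φ : E3 → ℝ) : Prop where
  smooth : ContDiff ℝ ∞ φ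
  compact : HasCompactSupport φ

namespace IsTest

variable {φ ψ : E3 → ℝ}

theorem continuous (h : IsTest φ) : Continuous φ := h.smooth.continuous

theorem differentiable (h : IsTest φ) : Differentiable ℝ φ :=
  h.smooth.differentiable (by simp)

theorem pd (h : IsTest φ) (i : Fin 3) : IsTest (pd i φ) where
  smooth := by
    have h1 : ContDiff ℝ ∞ (fderiv ℝ φ) := h.smooth.fderiv_right (by simp)
    exact h1.clm_apply contDiff_const
  compact := h.compact.fderiv_apply ℝ _

theorem sub (h : IsTest φ) (h' : IsTest ψ) : IsTest (fun x => φ x - ψ x) :=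
  ⟨h.smooth.sub h'.smooth, h.compact.sub h'.compact⟩

theorem mul (h : IsTest φ) (h' : IsTest ψ) : IsTest (fun x => φ x * ψ x) :=
  ⟨h.smooth.mul h'.smooth, h.compact.mul_right⟩

theorem const_mul (c : ℝ) (h : IsTest φ) : IsTest (fun x => c * φ x) :=
  ⟨contDiff_const.mul h.smooth, h.compact.mul_left⟩

theorem add (h : IsTest φ) (h' : IsTest ψ) : IsTest (fun x => φ x + ψ x) :=
  ⟨h.smooth.add h'.smooth, h.compact.add h'.compact⟩

theorem sum {φ : Fin 3 → E3 → ℝ} (h : ∀ i, IsTest (φ i)) : IsTest (fun x => ∑ i, φ i x) := by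
  simp only [Fin.sum_univ_three]
  exact ((h 0).add (h 1)).add (h 2)

theorem memLp (h : IsTest φ) (p : ℝ≥0∞) : MemLp φ p volume :=
  h.continuous.memLp_of_hasCompactSupport h.compact

theorem integrable (h : IsTest φ) : Integrable φ := memLp_one_iff_integrable.1 (h.memLp 1)

theorem exists_bound (h : IsTest φ) : ∃ C : ℝ, 0 ≤ C ∧ ∀ x, |φ x| ≤ C := by
  obtain ⟨C, hC⟩ := h.compact.exists_bound_of_continuous h.continuous
  exact ⟨C, (norm_nonneg _).trans (hC 0), hC⟩

theorem integrable_mul (h : IsTest φ) {f : E3 → ℝ} (hf : Integrable f) :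
    Integrable (fun x => f x * φ x) := by
  obtain ⟨C, -, hC⟩ := h.exists_bound
  exact hf.mul_bdd (c := C) h.continuous.aestronglyMeasurable (Eventually.of_forall hC)

theorem locallyIntegrable_mul (h : IsTest φ) {f : E3 → ℝ} (hf : LocallyIntegrable f) :
    Integrable (fun x => f x * φ x) := by
  have := hf.integrable_smul_left_of_hasCompactSupport h.continuous h.compact
  simpa [smul_eq_mul, mul_comm] using this

end IsTest

theorem pd_mul {f g : E3 → ℝ} {x : E3} (hf : DifferentiableAt ℝ f x)
    (hg : DifferentiableAt ℝ g x) (i : Fin 3) :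
    pd i (fun y => f y * g y) x = f x * pd i g x + pd i f x * g x := by
  unfold pd
  rw [fderiv_fun_mul hf hg]
  simp [mul_comm]

theorem pd_sub {f g : E3 → ℝ} {x : E3} (hf : DifferentiableAt ℝ f x)
    (hg : DifferentiableAt ℝ g x) (i : Fin 3) :
    pd i (fun y => f y - g y) x = pd i f x - pd i g x := by
  unfold pd
  rw [fderiv_fun_sub hf hg]
  simp

theorem pd_const_mul {f : E3 → ℝ} {x : E3} (hf : DifferentiableAt ℝ f x) (c : ℝ) (i : Fin 3) :
    pd i (fun y => c * f y) x = c * pd i f x := by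
  unfold pd
  rw [fderiv_const_mul hf]
  simp

theorem pd_comm {f : E3 → ℝ} (hf : ContDiff ℝ 2 f) (i j : Fin 3) (x : E3) :
    pd i (pd j f) x = pd j (pd i f) x := by
  have hd : DifferentiableAt ℝ (fderiv ℝ f) x :=
    (hf.fderiv_right (m := 1) (by norm_num)).differentiable (by simp) x
  have key (v w : E3) : fderiv ℝ (fun y => fderiv ℝ f y v) x w = fderiv ℝ (fderiv ℝ f) x w v := by
    rw [fderiv_clm_apply hd (differentiableAt_const v)]
    simp
  have hs : IsSymmSndFDerivAt ℝ f x := hf.contDiffAt.isSymmSndFDerivAt (by simp)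
  change fderiv ℝ (fun y => fderiv ℝ f y _) x _ = fderiv ℝ (fun y => fderiv ℝ f y _) x _
  rw [key, key]
  exact hs _ _

/-- Integration by parts on the whole space. -/
theorem integral_mul_pd {f g : E3 → ℝ} (i : Fin 3) (hf : Differentiable ℝ f)
    (hg : Differentiable ℝ g) (h1 : Integrable fun x => pd i f x * g x)
    (h2 : Integrable fun x => f x * pd i g x) (h3 : Integrable fun x => f x * g x) :
    ∫ x, f x * pd i g x = -∫ x, pd i f x * g x :=
  integral_mul_fderiv_eq_neg_fderiv_mul_of_integrable h1 h2 h3 (fun x _ => hf x) (fun x _ => hg x)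

theorem IsTest.integral_mul_pd {φ f : E3 → ℝ} (h : IsTest φ) (hf : ContDiff ℝ 1 f) (i : Fin 3) :
    ∫ x, f x * BarotropicNS.pd i φ x = -∫ x, BarotropicNS.pd i f x * φ x := by
  have hc : Continuous (BarotropicNS.pd i f) :=
    (hf.continuous_fderiv (by simp)).clm_apply continuous_const
  refine BarotropicNS.integral_mul_pd i (hf.differentiable (by simp)) h.differentiable ?_ ?_ ?_
  · exact h.locallyIntegrable_mul hc.locallyIntegrable
  · exact (h.pd i).locallyIntegrable_mul hf.continuous.locallyIntegrable
  · exact h.locallyIntegrable_mul hf.continuous.locallyIntegrable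

/-- Integrating by parts twice exchanges the two derivatives in `∫ ∂ᵢφ ∂ⱼψ`. -/
theorem IsTest.integral_pd_mul_pd_comm {φ ψ : E3 → ℝ} (hφ : IsTest φ) (hψ : IsTest ψ)
    (i j : Fin 3) :
    ∫ x, BarotropicNS.pd i φ x * BarotropicNS.pd j ψ x
      = ∫ x, BarotropicNS.pd j φ x * BarotropicNS.pd i ψ x := by
  rw [hψ.integral_mul_pd ((hφ.pd i).smooth.of_le (by simp)) j,
    hψ.integral_mul_pd ((hφ.pd j).smooth.of_le (by simp)) i]
  simp only [pd_comm (hφ.smooth.of_le (by norm_cast)) i j]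

/-! ### Convergence of sequences in Lebesgue spaces -/

/-- Convergence of a sequence of `L^p` functions on `ℝ³` to an `L^p` function, in the `L^p` norm. -/
structure LpTendsto (p : ℝ≥0∞) (F : ℕ → E3 → ℝ) (f : E3 → ℝ) : Prop where
  memLp : ∀ n, MemLp (F n) p volume
  memLp_lim : MemLp f p volume
  tendsto : Tendsto (fun n => eLpNorm (fun x => F n x - f x) p volume) atTop (𝓝 0)

/-- Hölder's inequality for a product of two real functions. -/
theorem eLpNorm_mul_le {p q r : ℝ≥0∞} [ENNReal.HolderTriple p q r] {f g : E3 → ℝ}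
    (hf : AEStronglyMeasurable f) (hg : AEStronglyMeasurable g) :
    eLpNorm (fun x => f x * g x) r volume ≤ eLpNorm f p volume * eLpNorm g q volume := by
  have h := eLpNorm_smul_le_mul_eLpNorm (p := p) (q := q) (r := r) hg hf
  have e : (fun x => f x * g x) = f • g := rfl
  rwa [e]

theorem memLp_mul {p q r : ℝ≥0∞} [ENNReal.HolderTriple p q r] {f g : E3 → ℝ}
    (hf : MemLp f p volume) (hg : MemLp g q volume) : MemLp (fun x => f x * g x) r volume :=
  MemLp.mul' (p := p) (q := q) hg hf

theorem integrable_mul {p q : ℝ≥0∞} [ENNReal.HolderConjugate p q] {f g : E3 → ℝ}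
    (hf : MemLp f p volume) (hg : MemLp g q volume) : Integrable (fun x => f x * g x) :=
  memLp_one_iff_integrable.1 (memLp_mul (p := p) (q := q) hf hg)

theorem abs_integral_le {f : E3 → ℝ} (hf : MemLp f 1 volume) :
    |∫ x, f x| ≤ (eLpNorm f 1 volume).toReal := by
  have h1 : Integrable f := memLp_one_iff_integrable.1 hf
  rw [eLpNorm_one_eq_lintegral_enorm, ← integral_norm_eq_lintegral_enorm hf.1]
  exact abs_integral_le_integral_abs

theorem abs_integral_mul_le {p q : ℝ≥0∞} [ENNReal.HolderConjugate p q] {f g : E3 → ℝ}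
    (hf : MemLp f p volume) (hg : MemLp g q volume) :
    |∫ x, f x * g x| ≤ (eLpNorm f p volume).toReal * (eLpNorm g q volume).toReal := by
  refine (abs_integral_le (memLp_mul (p := p) (q := q) hf hg)).trans ?_
  rw [← ENNReal.toReal_mul]
  exact ENNReal.toReal_mono (ENNReal.mul_ne_top hf.2.ne hg.2.ne) (eLpNorm_mul_le hf.1 hg.1)

namespace LpTendsto

variable {p q r : ℝ≥0∞} {F G : ℕ → E3 → ℝ} {f g : E3 → ℝ}

theorem const (hf : MemLp f p volume) : LpTendsto p (fun _ => f) f :=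
  ⟨fun _ => hf, hf, by simp⟩

theorem sub_lim (hF : LpTendsto p F f) (n : ℕ) : MemLp (fun x => F n x - f x) p volume :=
  (hF.memLp n).sub hF.memLp_lim

theorem tendsto_eLpNorm (hp : 1 ≤ p) (hF : LpTendsto p F f) :
    Tendsto (fun n => eLpNorm (F n) p volume) atTop (𝓝 (eLpNorm f p volume)) := by
  refine tendsto_of_tendsto_of_tendsto_of_le_of_le
    (g := fun n => eLpNorm f p volume - eLpNorm (fun x => F n x - f x) p volume)
    (h := fun n => eLpNorm f p volume + eLpNorm (fun x => F n x - f x) p volume) ?_ ?_ ?_ ?_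
  · have := ENNReal.Tendsto.sub (tendsto_const_nhds (x := eLpNorm f p volume)) hF.tendsto
      (Or.inr ENNReal.zero_ne_top)
    simpa using this
  · simpa using tendsto_const_nhds.add hF.tendsto
  · intro n
    refine tsub_le_iff_right.2 ?_
    calc eLpNorm f p volume = eLpNorm (F n - fun x => F n x - f x) p volume := by
          refine congrArg (fun h => eLpNorm h _ volume) (funext fun x => ?_)
          simp
      _ ≤ _ := eLpNorm_sub_le (hF.memLp n).1 (hF.sub_lim n).1 hp
  · intro n
    calc eLpNorm (F n) p volume = eLpNorm (f + fun x => F n x - f x) p volume := by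
          refine congrArg (fun h => eLpNorm h _ volume) (funext fun x => ?_)
          simp
      _ ≤ _ := eLpNorm_add_le hF.memLp_lim.1 (hF.sub_lim n).1 hp

theorem add (hp : 1 ≤ p) (hF : LpTendsto p F f) (hG : LpTendsto p G g) :
    LpTendsto p (fun n x => F n x + G n x) (fun x => f x + g x) := by
  refine ⟨fun n => (hF.memLp n).add (hG.memLp n), hF.memLp_lim.add hG.memLp_lim, ?_⟩
  have h0 := hF.tendsto.add hG.tendsto
  rw [add_zero] at h0
  refine tendsto_of_tendsto_of_tendsto_of_le_of_le tendsto_const_nhds h0 (fun n => zero_le) ?_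
  intro n
  calc _ = eLpNorm ((fun x => F n x - f x) + fun x => G n x - g x) p volume := by
        refine congrArg (fun h => eLpNorm h _ volume) (funext fun x => ?_)
        simp only [Pi.add_apply]; ring
    _ ≤ _ := eLpNorm_add_le (hF.sub_lim n).1 (hG.sub_lim n).1 hp

theorem const_mul (c : ℝ) (hF : LpTendsto p F f) :
    LpTendsto p (fun n x => c * F n x) (fun x => c * f x) := by
  refine ⟨fun n => (hF.memLp n).const_mul c, hF.memLp_lim.const_mul c, ?_⟩
  have h0 := ENNReal.Tendsto.const_mul (a := ‖c‖ₑ) hF.tendsto (Or.inr (by simp))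
  rw [mul_zero] at h0
  refine h0.congr fun n => ?_
  rw [← eLpNorm_const_smul]
  refine congrArg (fun h => eLpNorm h _ volume) (funext fun x => ?_)
  simp only [Pi.smul_apply, smul_eq_mul]; ring

theorem sum (hp : 1 ≤ p) {F : Fin 3 → ℕ → E3 → ℝ} {f : Fin 3 → E3 → ℝ}
    (h : ∀ i, LpTendsto p (F i) (f i)) :
    LpTendsto p (fun n x => ∑ i, F i n x) (fun x => ∑ i, f i x) := by
  simp only [Fin.sum_univ_three]
  exact ((h 0).add hp (h 1)).add hp (h 2)

theorem mul [hr : ENNReal.HolderTriple p q r] (hr1 : 1 ≤ r)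
    (hF : LpTendsto p F f) (hG : LpTendsto q G g) :
    LpTendsto r (fun n x => F n x * G n x) (fun x => f x * g x) := by
  have hq1 : 1 ≤ q := hr1.trans (ENNReal.HolderTriple.le q p r)
  refine ⟨fun n => memLp_mul (p := p) (q := q) (hF.memLp n) (hG.memLp n),
    memLp_mul (p := p) (q := q) hF.memLp_lim hG.memLp_lim, ?_⟩
  have h0 : Tendsto (fun n => eLpNorm (fun x => F n x - f x) p volume * eLpNorm (G n) q volume
      + eLpNorm f p volume * eLpNorm (fun x => G n x - g x) q volume) atTop (𝓝 0) := by
    have h1 := ENNReal.Tendsto.mul hF.tendsto (Or.inr hG.memLp_lim.2.ne)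
      (hG.tendsto_eLpNorm hq1) (Or.inr ENNReal.zero_ne_top)
    have h2 := ENNReal.Tendsto.const_mul (a := eLpNorm f p volume) hG.tendsto
      (Or.inr hF.memLp_lim.2.ne)
    simpa using h1.add h2
  refine tendsto_of_tendsto_of_tendsto_of_le_of_le tendsto_const_nhds h0 (fun n => zero_le) ?_
  intro n
  calc _ = eLpNorm ((fun x => (F n x - f x) * G n x) + fun x => f x * (G n x - g x)) r volume := by
        refine congrArg (fun h => eLpNorm h _ volume) (funext fun x => ?_)
        simp only [Pi.add_apply]; ring
    _ ≤ _ := eLpNorm_add_le (memLp_mul (p := p) (q := q) (r := r) (hF.sub_lim n) (hG.memLp n)).1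
        (memLp_mul (p := p) (q := q) (r := r) hF.memLp_lim (hG.sub_lim n)).1 hr1
    _ ≤ _ := add_le_add (eLpNorm_mul_le (hF.sub_lim n).1 (hG.memLp n).1)
        (eLpNorm_mul_le hF.memLp_lim.1 (hG.sub_lim n).1)

theorem tendsto_integral (hF : LpTendsto 1 F f) :
    Tendsto (fun n => ∫ x, F n x) atTop (𝓝 (∫ x, f x)) := by
  refine tendsto_integral_of_L1' f hF.memLp_lim.1
    (Eventually.of_forall fun n => memLp_one_iff_integrable.1 (hF.memLp n)) ?_
  exact hF.tendsto

theorem tendsto_integral_mul [ENNReal.HolderConjugate p q] (hF : LpTendsto p F f)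
    (hG : LpTendsto q G g) :
    Tendsto (fun n => ∫ x, F n x * G n x) atTop (𝓝 (∫ x, f x * g x)) :=
  (hF.mul (r := 1) le_rfl hG).tendsto_integral

theorem comp_subseq (hF : LpTendsto p F f) {k : ℕ → ℕ} (hk : Tendsto k atTop atTop) :
    LpTendsto p (fun n => F (k n)) f :=
  ⟨fun _ => hF.memLp _, hF.memLp_lim, hF.tendsto.comp hk⟩

theorem congr_lim (hF : LpTendsto p F f) (h : f =ᵐ[volume] g) : LpTendsto p F g := by
  refine ⟨hF.memLp, hF.memLp_lim.ae_eq h, hF.tendsto.congr fun n => eLpNorm_congr_ae ?_⟩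
  filter_upwards [h] with x hx
  rw [hx]

theorem exists_subseq_ae (hp : p ≠ 0) (hF : LpTendsto p F f) :
    ∃ k : ℕ → ℕ, StrictMono k ∧
      ∀ᵐ x, Tendsto (fun n => F (k n) x) atTop (𝓝 (f x)) :=
  (tendstoInMeasure_of_tendsto_eLpNorm hp (fun n => (hF.memLp n).1) hF.memLp_lim.1
    hF.tendsto).exists_seq_tendsto_ae

end LpTendsto

/-- Lower semicontinuity of one Lebesgue norm under convergence in another. -/
theorem LpTendsto.eLpNorm_le_of_tendsto {p q : ℝ≥0∞} {F : ℕ → E3 → ℝ} {f : E3 → ℝ} (hp : p ≠ 0)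
    (hF : LpTendsto p F f) {B : ℕ → ℝ≥0∞} {b : ℝ≥0∞} (hB : ∀ n, eLpNorm (F n) q volume ≤ B n)
    (hb : Tendsto B atTop (𝓝 b)) : eLpNorm f q volume ≤ b := by
  obtain ⟨k, hk, hae⟩ := hF.exists_subseq_ae hp
  refine (Lp.eLpNorm_lim_le_liminf_eLpNorm (fun n => (hF.memLp (k n)).1) f hae).trans ?_
  rw [← (hb.comp hk.tendsto_atTop).liminf_eq]
  exact liminf_le_liminf (Eventually.of_forall fun n => hB (k n))

/-- A real Hölder relation `1/a + 1/b = 1/c`, for extended exponents. -/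
theorem holderTriple_ofReal {a b c : ℝ} (ha : 0 < a) (hb : 0 < b) (hc : 0 < c)
    (h : 1 / a + 1 / b = 1 / c) :
    ENNReal.HolderTriple (ENNReal.ofReal a) (ENNReal.ofReal b) (ENNReal.ofReal c) where
  inv_add_inv_eq_inv := by
    rw [← ENNReal.ofReal_inv_of_pos ha, ← ENNReal.ofReal_inv_of_pos hb,
      ← ENNReal.ofReal_inv_of_pos hc, ← ENNReal.ofReal_add (by positivity) (by positivity)]
    congr 1
    simpa [one_div] using h

theorem memLp_ofReal_iff {f : E3 → ℝ} {p : ℝ} (hp : 0 < p) (hf : AEStronglyMeasurable f) :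
    MemLp f (ENNReal.ofReal p) volume ↔ Integrable fun x => |f x| ^ p := by
  have := integrable_norm_rpow_iff (μ := volume) (p := ENNReal.ofReal p) hf
    (by simpa using hp) ENNReal.ofReal_ne_top
  rw [← this, ENNReal.toReal_ofReal hp.le]
  rfl

/-- A function in `L^a ∩ L^b` is in every intermediate Lebesgue space. -/
theorem memLp_of_memLp_of_memLp {f : E3 → ℝ} {a b c : ℝ} (ha : 0 < a) (hac : a ≤ c) (hcb : c ≤ b)
    (h1 : MemLp f (ENNReal.ofReal a) volume) (h2 : MemLp f (ENNReal.ofReal b) volume) :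
    MemLp f (ENNReal.ofReal c) volume := by
  have hc := ha.trans_le hac
  have hm : AEStronglyMeasurable f := h1.1
  rw [memLp_ofReal_iff ha h1.1] at h1
  rw [memLp_ofReal_iff (hc.trans_le hcb) h2.1] at h2
  rw [memLp_ofReal_iff hc hm]
  refine (h1.add h2).mono' (hm.norm.aemeasurable.pow_const c).aestronglyMeasurable
    (Eventually.of_forall fun x => ?_)
  have h0 := abs_nonneg (f x)
  rw [Real.norm_of_nonneg (Real.rpow_nonneg h0 _)]
  simp only [Pi.add_apply]
  rcases le_total (|f x|) 1 with h | h
  · rcases h0.eq_or_lt with h' | h'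
    · rw [← h', Real.zero_rpow hc.ne', Real.zero_rpow ha.ne']
      simp [Real.zero_rpow_nonneg]
    · exact (Real.rpow_le_rpow_of_exponent_ge h' h hac).trans
        (le_add_of_nonneg_right (Real.rpow_nonneg h0 _))
  · exact (Real.rpow_le_rpow_of_exponent_le h hcb).trans
        (le_add_of_nonneg_left (Real.rpow_nonneg h0 _))

/-! ### Averages of translates and mollification -/

theorem eLpNorm_translate {f : E3 → ℝ} (hf : Measurable f) (p : ℝ≥0∞) (h : E3) :
    eLpNorm (fun x => f (x - h)) p volume = eLpNorm f p volume :=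
  eLpNorm_comp_measurePreserving (g := f) hf.aestronglyMeasurable
    (measurePreserving_sub_right volume h)

theorem memLp_translate {f : E3 → ℝ} {p : ℝ≥0∞} (hf : MemLp f p volume) (h : E3) :
    MemLp (fun x => f (x - h)) p volume :=
  hf.comp_measurePreserving (measurePreserving_sub_right volume h)

/-- Translations act continuously on `L^p` for finite `p`. -/
theorem lpTendsto_translate {f : E3 → ℝ} {p : ℝ≥0∞} (hp : 1 ≤ p) (hp' : p ≠ ⊤)
    (hf : MemLp f p volume) {h : ℕ → E3} (hh : Tendsto h atTop (𝓝 0)) :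
    LpTendsto p (fun n x => f (x - h n)) f := by
  refine ⟨fun n => memLp_translate hf _, hf, ?_⟩
  have : Fact (1 ≤ p) := ⟨hp⟩
  let τ : E3 → C(E3, E3) := fun a => ⟨fun x => x - a, by fun_prop⟩
  have hτm (a : E3) : MeasurePreserving (τ a) volume volume := measurePreserving_sub_right volume a
  have hτ : Continuous τ :=
    (ContinuousMap.mk (fun q : E3 × E3 => q.2 - q.1) (by fun_prop)).curry.continuous
  have key := Filter.Tendsto.compMeasurePreservingLp (μ := volume) (ν := volume)
    (tendsto_const_nhds (x := hf.toLp f)) ((hτ.tendsto 0).comp hh) (fun n => hτm (h n)) (hτm 0) hp'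
  rw [Lp.tendsto_Lp_iff_tendsto_eLpNorm'] at key
  refine key.congr fun n => eLpNorm_congr_ae ?_
  have h1 := Lp.coeFn_compMeasurePreserving (hf.toLp f) (hτm (h n))
  have h2 := Lp.coeFn_compMeasurePreserving (hf.toLp f) (hτm 0)
  have h3 := (hτm (h n)).quasiMeasurePreserving.ae (hf.coeFn_toLp)
  have h4 := (hτm 0).quasiMeasurePreserving.ae (hf.coeFn_toLp)
  filter_upwards [h1, h2, h3, h4] with x e1 e2 e3 e4
  rw [Pi.sub_apply]
  simp only [Function.comp_apply] at e1 e2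
  refine (congrArg₂ (· - ·) (e1.trans e3) (e2.trans e4)).trans ?_
  simp [τ]

/-- Jensen's inequality for averages over a finite measure, integrated over `ℝ³`. -/
theorem lintegral_rpow_lintegral_le {Z : Type*} [MeasurableSpace Z] (ν : Measure Z)
    [IsFiniteMeasure ν] {p : ℝ} (hp : 1 ≤ p) {b : E3 → Z → ℝ≥0∞}
    (hb : Measurable (Function.uncurry b)) :
    ∫⁻ x, (∫⁻ z, b x z ∂ν) ^ p
      ≤ ν Set.univ ^ (p - 1) * ∫⁻ z, (∫⁻ x, b x z ^ p) ∂ν := by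
  have hp0 : 0 < p := by linarith
  have h1 (x : E3) : (∫⁻ z, b x z ∂ν) ^ p ≤ ν Set.univ ^ (p - 1) * ∫⁻ z, b x z ^ p ∂ν := by
    have hm : Measurable (b x) := hb.comp measurable_prodMk_left
    have h := eLpNorm'_le_eLpNorm'_mul_rpow_measure_univ (μ := ν) (f := b x) one_pos hp
      hm.aestronglyMeasurable
    simp only [eLpNorm'_eq_lintegral_enorm, enorm_eq_self, ENNReal.rpow_one, div_one] at h
    calc (∫⁻ z, b x z ∂ν) ^ p
        ≤ ((∫⁻ z, b x z ^ p ∂ν) ^ (1 / p) * ν Set.univ ^ (1 - 1 / p)) ^ p := by gcongr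
      _ = _ := by
        rw [ENNReal.mul_rpow_of_nonneg _ _ hp0.le, ← ENNReal.rpow_mul, ← ENNReal.rpow_mul,
          mul_comm]
        congr 2
        · field_simp
        · rw [one_div_mul_cancel hp0.ne', ENNReal.rpow_one]
  calc _ ≤ ∫⁻ x, ν Set.univ ^ (p - 1) * ∫⁻ z, b x z ^ p ∂ν := lintegral_mono h1
    _ = ν Set.univ ^ (p - 1) * ∫⁻ x, ∫⁻ z, b x z ^ p ∂ν := by
      rw [lintegral_const_mul]
      exact Measurable.lintegral_prod_right' (f := fun q : E3 × Z => b q.1 q.2 ^ p)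
        (hb.pow_const p)
    _ = _ := by
      rw [lintegral_lintegral_swap]
      exact (hb.pow_const p).aemeasurable

theorem eLpNorm_ofReal_rpow {f : E3 → ℝ} {p : ℝ} (hp : 0 < p) :
    eLpNorm f (ENNReal.ofReal p) volume ^ p = ∫⁻ x, ‖f x‖ₑ ^ p := by
  rw [eLpNorm_eq_lintegral_rpow_enorm_toReal (by simpa using hp) ENNReal.ofReal_ne_top,
    ENNReal.toReal_ofReal hp.le, ← ENNReal.rpow_mul, one_div_mul_cancel hp.ne', ENNReal.rpow_one]

/-- Averaging the translates of an `L^p` function over a measure `ν` multiplies its norm by at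
most the total mass of `ν`, at every scale. -/
theorem lintegral_average_translate_le (ν : Measure E3) [IsFiniteMeasure ν] {p : ℝ} (hp : 1 ≤ p)
    {f : E3 → ℝ} (hf : Measurable f) (ε : ℝ) :
    ∫⁻ x, (∫⁻ z, ‖f (x - ε • z)‖ₑ ∂ν) ^ p
      ≤ (ν Set.univ * eLpNorm f (ENNReal.ofReal p) volume) ^ p := by
  have hp0 : 0 < p := by linarith
  have hb : Measurable (Function.uncurry fun (x z : E3) => ‖f (x - ε • z)‖ₑ) :=
    (hf.comp (measurable_fst.sub (measurable_snd.const_smul ε))).enorm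
  refine (lintegral_rpow_lintegral_le ν hp hb).trans ?_
  have h1 (z : E3) : ∫⁻ x, ‖f (x - ε • z)‖ₑ ^ p = eLpNorm f (ENNReal.ofReal p) volume ^ p := by
    rw [← eLpNorm_translate hf (ENNReal.ofReal p) (ε • z), eLpNorm_ofReal_rpow hp0]
  simp only [h1, lintegral_const]
  rw [ENNReal.mul_rpow_of_nonneg _ _ hp0.le, mul_comm (_ ^ p) (ν _), ← mul_assoc]
  gcongr
  conv_lhs => rw [← ENNReal.rpow_one (ν Set.univ)]
  rw [← ENNReal.rpow_mul, one_mul]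
  rcases eq_or_ne (ν Set.univ) 0 with h | h
  · rw [h]; simp [hp0]
  · rw [← ENNReal.rpow_add _ _ h (measure_ne_top ν _)]
    simp

/-- The average oscillation of an `L^p` function at scale `ε` tends to `0` with `ε`. -/
theorem tendsto_lintegral_oscillation (ν : Measure E3) [IsFiniteMeasure ν] {p : ℝ} (hp : 1 ≤ p)
    {f : E3 → ℝ} (hf : Measurable f) (hfp : MemLp f (ENNReal.ofReal p) volume)
    {ε : ℕ → ℝ} (hε : Tendsto ε atTop (𝓝 0)) :
    Tendsto (fun n => ∫⁻ x, (∫⁻ z, ‖f (x - ε n • z) - f x‖ₑ ∂ν) ^ p) atTop (𝓝 0) := by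
  have hp0 : 0 < p := by linarith
  have hp1 : 1 ≤ ENNReal.ofReal p := ENNReal.one_le_ofReal.2 hp
  have hb (n : ℕ) : Measurable (Function.uncurry fun (x z : E3) => ‖f (x - ε n • z) - f x‖ₑ) :=
    ((hf.comp (measurable_fst.sub (measurable_snd.const_smul (ε n)))).sub
      (hf.comp measurable_fst)).enorm
  have h1 (n : ℕ) (z : E3) : ∫⁻ x, ‖f (x - ε n • z) - f x‖ₑ ^ p
      = eLpNorm (fun x => f (x - ε n • z) - f x) (ENNReal.ofReal p) volume ^ p :=
    (eLpNorm_ofReal_rpow hp0).symm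
  have h2 : Tendsto (fun n => ∫⁻ z, (∫⁻ x, ‖f (x - ε n • z) - f x‖ₑ ^ p) ∂ν) atTop (𝓝 0) := by
    have h3 := tendsto_lintegral_of_dominated_convergence (μ := ν)
      (F := fun n z => ∫⁻ x, ‖f (x - ε n • z) - f x‖ₑ ^ p) (f := fun _ => 0)
      (fun _ => (2 * eLpNorm f (ENNReal.ofReal p) volume) ^ p) ?_ ?_ ?_ ?_
    · simpa using h3
    · intro n
      exact Measurable.lintegral_prod_left' (f := fun q : E3 × E3 =>
        ‖f (q.1 - ε n • q.2) - f q.1‖ₑ ^ p) ((hb n).pow_const p)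
    · intro n
      refine Eventually.of_forall fun z => ?_
      dsimp only
      rw [h1]
      gcongr
      refine (eLpNorm_sub_le (memLp_translate hfp _).1 hfp.1 hp1).trans ?_
      rw [eLpNorm_translate hf, two_mul]
    · rw [lintegral_const]
      exact ENNReal.mul_ne_top (ENNReal.rpow_ne_top_of_nonneg hp0.le
        (ENNReal.mul_ne_top (by simp) hfp.2.ne)) (measure_ne_top ν _)
    · refine Eventually.of_forall fun z => ?_
      simp only [h1]
      have hz : Tendsto (fun n => ε n • z) atTop (𝓝 0) := by simpa using hε.smul_const z
      have := (lpTendsto_translate hp1 ENNReal.ofReal_ne_top hfp hz).tendsto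
      have h4 := (ENNReal.continuous_rpow_const (y := p)).tendsto 0 |>.comp this
      simpa [Function.comp_def, ENNReal.zero_rpow_of_pos hp0] using h4
  have h5 := ENNReal.Tendsto.const_mul (a := ν Set.univ ^ (p - 1)) h2
    (Or.inr (ENNReal.rpow_ne_top_of_nonneg (by linarith) (measure_ne_top ν _)))
  rw [mul_zero] at h5
  exact tendsto_of_tendsto_of_tendsto_of_le_of_le tendsto_const_nhds h5 (fun n => zero_le)
    fun n => lintegral_rpow_lintegral_le ν hp (hb n)

/-- The average `∫ k(z) f(x - εz) dz` of the translates of `f` at scale `ε` with weight `k`. -/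
def avg (k : E3 → ℝ) (ε : ℝ) (f : E3 → ℝ) (x : E3) : ℝ := ∫ z, k z * f (x - ε • z)

/-- The measure with density `|k|`. -/
def weight (k : E3 → ℝ) : Measure E3 := volume.withDensity fun z => ‖k z‖ₑ

theorem lintegral_weight {k : E3 → ℝ} (hk : IsTest k) {b : E3 → ℝ≥0∞} (hb : Measurable b) :
    ∫⁻ z, b z ∂weight k = ∫⁻ z, ‖k z‖ₑ * b z := by
  rw [weight, lintegral_withDensity_eq_lintegral_mul _ hk.continuous.measurable.enorm hb]
  rfl

theorem isFiniteMeasure_weight {k : E3 → ℝ} (hk : IsTest k) : IsFiniteMeasure (weight k) :=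
  isFiniteMeasure_withDensity hk.integrable.2.ne

theorem enorm_avg_le {k : E3 → ℝ} (hk : IsTest k) (ε : ℝ) {f : E3 → ℝ} (hf : Measurable f)
    (x : E3) : ‖avg k ε f x‖ₑ ≤ ∫⁻ z, ‖f (x - ε • z)‖ₑ ∂weight k := by
  have hb : Measurable fun z => ‖f (x - ε • z)‖ₑ :=
    (hf.comp (measurable_const.sub (measurable_id.const_smul ε))).enorm
  rw [lintegral_weight hk hb]
  refine (enorm_integral_le_lintegral_enorm _).trans_eq ?_
  simp only [enorm_mul]

theorem measurable_avg {k : E3 → ℝ} (hk : IsTest k) (ε : ℝ) {f : E3 → ℝ} (hf : Measurable f) :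
    Measurable (avg k ε f) := by
  have : Measurable fun q : E3 × E3 => k q.2 * f (q.1 - ε • q.2) :=
    (hk.continuous.measurable.comp measurable_snd).mul
      (hf.comp (measurable_fst.sub (measurable_snd.const_smul ε)))
  exact this.stronglyMeasurable.integral_prod_right.measurable

/-- **Young's inequality** for averages of translates, with a constant independent of the scale. -/
theorem eLpNorm_avg_le {k : E3 → ℝ} (hk : IsTest k) {p : ℝ} (hp : 1 ≤ p) (ε : ℝ) {f : E3 → ℝ}
    (hf : Measurable f) : eLpNorm (avg k ε f) (ENNReal.ofReal p) volume
      ≤ weight k Set.univ * eLpNorm f (ENNReal.ofReal p) volume := by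
  have hp0 : 0 < p := by linarith
  have := isFiniteMeasure_weight hk
  rw [← ENNReal.rpow_le_rpow_iff hp0, eLpNorm_ofReal_rpow hp0]
  refine le_trans (lintegral_mono fun x => ?_) (lintegral_average_translate_le (weight k) hp hf ε)
  exact ENNReal.rpow_le_rpow (enorm_avg_le hk ε hf x) hp0.le

theorem memLp_avg {k : E3 → ℝ} (hk : IsTest k) {p : ℝ} (hp : 1 ≤ p) (ε : ℝ) {f : E3 → ℝ}
    (hf : Measurable f) (hfp : MemLp f (ENNReal.ofReal p) volume) :
    MemLp (avg k ε f) (ENNReal.ofReal p) volume := by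
  have := isFiniteMeasure_weight hk
  exact ⟨(measurable_avg hk ε hf).aestronglyMeasurable, (eLpNorm_avg_le hk hp ε hf).trans_lt
    (ENNReal.mul_lt_top (measure_lt_top _ _) hfp.2)⟩

/-- The kernel turning the average of translates at scale `ε` into a convolution. -/
def scaled (k : E3 → ℝ) (ε : ℝ) (y : E3) : ℝ := |(ε ^ 3)⁻¹| * k (ε⁻¹ • y)

theorem IsTest.scaled {k : E3 → ℝ} (hk : IsTest k) {ε : ℝ} (hε : ε ≠ 0) :
    IsTest (scaled k ε) where
  smooth := contDiff_const.mul (hk.smooth.comp (contDiff_const_smul ε⁻¹))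
  compact := by
    have : HasCompactSupport fun y : E3 => k (ε⁻¹ • y) :=
      hk.compact.comp_homeomorph (Homeomorph.smulOfNeZero _ (inv_ne_zero hε))
    exact this.mul_left

open scoped Convolution in
theorem avg_eq_convolution (k : E3 → ℝ) {ε : ℝ} (hε : ε ≠ 0) (f : E3 → ℝ) :
    avg k ε f = (scaled k ε ⋆[ContinuousLinearMap.lsmul ℝ ℝ, volume] f) := by
  ext x
  have h := Measure.integral_comp_smul (volume : Measure E3)
    (fun y => k (ε⁻¹ • y) * f (x - y)) ε
  simp only [inv_smul_smul₀ hε, finrank_euclideanSpace, Fintype.card_fin] at h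
  rw [avg, h, convolution_def, smul_eq_mul, ← integral_const_mul]
  simp [scaled, mul_assoc]

theorem pd_scaled {k : E3 → ℝ} (hk : IsTest k) (ε : ℝ) (i : Fin 3) (y : E3) :
    pd i (scaled k ε) y = ε⁻¹ * scaled (pd i k) ε y := by
  have h0 : HasFDerivAt (fun y : E3 => ε⁻¹ • y) (ε⁻¹ • ContinuousLinearMap.id ℝ E3) y :=
    (hasFDerivAt_id y).const_smul ε⁻¹
  have h : HasFDerivAt (scaled k ε)
      (|(ε ^ 3)⁻¹| • ((fderiv ℝ k (ε⁻¹ • y)).comp (ε⁻¹ • ContinuousLinearMap.id ℝ E3))) y :=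
    ((hk.differentiable (ε⁻¹ • y)).hasFDerivAt.comp y h0).const_smul |(ε ^ 3)⁻¹|
  rw [pd, h.fderiv, scaled, pd]
  simp
  ring

theorem contDiff_avg {k : E3 → ℝ} (hk : IsTest k) {ε : ℝ} (hε : ε ≠ 0) {f : E3 → ℝ}
    (hf : LocallyIntegrable f) : ContDiff ℝ ∞ (avg k ε f) := by
  rw [avg_eq_convolution k hε f]
  exact (hk.scaled hε).compact.contDiff_convolution_left _ (hk.scaled hε).smooth hf

/-- A derivative of an average of translates falls on the weight. -/
theorem pd_avg {k : E3 → ℝ} (hk : IsTest k) {ε : ℝ} (hε : ε ≠ 0) {f : E3 → ℝ}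
    (hf : LocallyIntegrable f) (i : Fin 3) (x : E3) :
    pd i (avg k ε f) x = ε⁻¹ * avg (pd i k) ε f x := by
  have hs := hk.scaled hε
  have h := hs.compact.hasFDerivAt_convolution_left (ContinuousLinearMap.lsmul ℝ ℝ)
    (hs.smooth.of_le (by simp)) hf x
  rw [avg_eq_convolution _ hε, avg_eq_convolution _ hε, pd, h.fderiv, convolution_def,
    convolution_def, ← integral_const_mul, ContinuousLinearMap.integral_apply]
  · refine integral_congr_ae (Eventually.of_forall fun t => ?_)
    have := pd_scaled hk ε i t
    simp only [pd] at this
    simp [ContinuousLinearMap.precompL_apply, this, mul_assoc]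
  · exact (hs.compact.fderiv ℝ).convolutionExists_left _
      (hs.smooth.continuous_fderiv (by simp)) hf x

theorem IsTest.avg {k φ : E3 → ℝ} (hk : IsTest k) (hφ : IsTest φ) {ε : ℝ} (hε : ε ≠ 0) :
    IsTest (avg k ε φ) where
  smooth := contDiff_avg hk hε hφ.continuous.locallyIntegrable
  compact := by
    rw [avg_eq_convolution k hε φ]
    exact (hk.scaled hε).compact.convolution _ hφ.compact

/-- Averages of translates commute with derivatives. -/
theorem IsTest.pd_avg {k φ : E3 → ℝ} (hk : IsTest k) (hφ : IsTest φ) {ε : ℝ} (hε : ε ≠ 0)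
    (i : Fin 3) (x : E3) :
    BarotropicNS.pd i (BarotropicNS.avg k ε φ) x
      = BarotropicNS.avg k ε (BarotropicNS.pd i φ) x := by
  have hs := hk.scaled hε
  have h := hφ.compact.hasFDerivAt_convolution_right (ContinuousLinearMap.lsmul ℝ ℝ)
    hs.continuous.locallyIntegrable (μ := volume) (hφ.smooth.of_le (by simp)) x
  rw [avg_eq_convolution _ hε, avg_eq_convolution _ hε, BarotropicNS.pd, h.fderiv, convolution_def,
    convolution_def, ContinuousLinearMap.integral_apply]
  · refine integral_congr_ae (Eventually.of_forall fun t => ?_)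
    simp [ContinuousLinearMap.precompR_apply, BarotropicNS.pd]
  · exact (hφ.compact.fderiv ℝ).convolutionExists_right _
      hs.continuous.locallyIntegrable (hφ.smooth.continuous_fderiv (by simp)) x

theorem integrable_mul_translate {k : E3 → ℝ} (hk : IsTest k) {ε : ℝ} (hε : ε ≠ 0) {f : E3 → ℝ}
    (hf : LocallyIntegrable f) (x : E3) : Integrable fun z => k z * f (x - ε • z) := by
  have hs := hk.scaled hε
  have h : Integrable fun y => scaled k ε y * f (x - y) :=
    hs.compact.convolutionExists_left (ContinuousLinearMap.lsmul ℝ ℝ) hs.continuous hf x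
  have h2 : Integrable fun z => scaled k ε (ε • z) * f (x - ε • z) :=
    h.comp_smul (μ := (volume : Measure E3)) hε
  have h3 := h2.const_mul |ε ^ 3|
  refine h3.congr (Eventually.of_forall fun z => ?_)
  have : |ε ^ 3| ≠ 0 := abs_ne_zero.2 (pow_ne_zero 3 hε)
  simp only [scaled, inv_smul_smul₀ hε, abs_inv]
  field_simp

/-- An even mollifier: a nonnegative even test function of integral one. -/
structure IsMollifier (k : E3 → ℝ) : Prop extends IsTest k where
  nonneg : ∀ z, 0 ≤ k z
  even : ∀ z, k (-z) = k z
  integral_eq_one : ∫ z, k z = 1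

theorem exists_isMollifier : ∃ k : E3 → ℝ, IsMollifier k := by
  let b : ContDiffBump (0 : E3) := ⟨1, 2, one_pos, one_lt_two⟩
  exact ⟨b.normed volume, ⟨⟨b.contDiff_normed, b.hasCompactSupport_normed⟩,
    b.nonneg_normed, fun z => b.normed_neg z, b.integral_normed⟩⟩

/-- Mollifications of an `L^p` function converge to it in `L^p`. -/
theorem IsMollifier.lpTendsto_avg {k : E3 → ℝ} (hk : IsMollifier k) {p : ℝ} (hp : 1 ≤ p)
    {f : E3 → ℝ} (hf : Measurable f) (hfp : MemLp f (ENNReal.ofReal p) volume)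
    {ε : ℕ → ℝ} (hε : Tendsto ε atTop (𝓝 0)) (hε0 : ∀ n, ε n ≠ 0) :
    LpTendsto (ENNReal.ofReal p) (fun n => avg k (ε n) f) f := by
  have hp0 : 0 < p := by linarith
  have hkt := hk.toIsTest
  have := isFiniteMeasure_weight hkt
  have hloc : LocallyIntegrable f := hfp.locallyIntegrable (ENNReal.one_le_ofReal.2 hp)
  refine ⟨fun n => memLp_avg hkt hp _ hf hfp, hfp, ?_⟩
  have h1 := tendsto_lintegral_oscillation (weight k) hp hf hfp hε
  have h2 (n : ℕ) : eLpNorm (fun x => avg k (ε n) f x - f x) (ENNReal.ofReal p) volume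
      ≤ (∫⁻ x, (∫⁻ z, ‖f (x - ε n • z) - f x‖ₑ ∂weight k) ^ p) ^ p⁻¹ := by
    rw [← ENNReal.rpow_le_rpow_iff hp0, eLpNorm_ofReal_rpow hp0, ENNReal.rpow_inv_rpow hp0.ne']
    refine lintegral_mono fun x => ENNReal.rpow_le_rpow ?_ hp0.le
    have e : avg k (ε n) f x - f x = ∫ z, k z * (f (x - ε n • z) - f x) := by
      simp only [mul_sub]
      rw [integral_sub (integrable_mul_translate hkt (hε0 n) hloc x)
        (hkt.integrable.mul_const _), integral_mul_const, hk.integral_eq_one, one_mul, avg]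
    have hb : Measurable fun z => ‖f (x - ε n • z) - f x‖ₑ :=
      ((hf.comp (measurable_const.sub (measurable_id.const_smul (ε n)))).sub_const _).enorm
    rw [e, lintegral_weight hkt hb]
    refine (enorm_integral_le_lintegral_enorm _).trans_eq ?_
    simp only [enorm_mul]
  have h3 := (ENNReal.continuous_rpow_const (y := p⁻¹)).tendsto 0 |>.comp h1
  rw [ENNReal.zero_rpow_of_pos (by positivity)] at h3
  exact tendsto_of_tendsto_of_tendsto_of_le_of_le tendsto_const_nhds h3 (fun n => zero_le) h2

theorem exists_bound_avg {k : E3 → ℝ} (hk : IsTest k) {ε : ℝ} (hε : ε ≠ 0) {f : E3 → ℝ}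
    (hf : Integrable f) : ∃ C, ∀ x, |avg k ε f x| ≤ C := by
  obtain ⟨C, hC0, hC⟩ := (hk.scaled hε).exists_bound
  refine ⟨C * ∫ y, |f y|, fun x => ?_⟩
  have hi : Integrable fun y => |f (x - y)| := (hf.comp_sub_left x).abs
  rw [avg_eq_convolution k hε f, convolution_def,
    ← integral_sub_left_eq_self (fun y => |f y|) volume x, ← integral_const_mul]
  refine abs_integral_le_integral_abs.trans (integral_mono_of_nonneg
    (Eventually.of_forall fun _ => abs_nonneg _) (hi.const_mul C)
    (Eventually.of_forall fun y => ?_))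
  simp only [ContinuousLinearMap.lsmul_apply, smul_eq_mul, abs_mul]
  exact mul_le_mul_of_nonneg_right (hC y) (abs_nonneg _)

/-- Mollification is self-adjoint. -/
theorem IsMollifier.integral_avg_mul {k : E3 → ℝ} (hk : IsMollifier k) (ε : ℝ)
    {f φ : E3 → ℝ} (hf : Integrable f) (hφ : IsTest φ) :
    ∫ x, avg k ε f x * φ x = ∫ x, f x * avg k ε φ x := by
  have hkt := hk.toIsTest
  have hφm := hφ.continuous.measurable
  obtain ⟨C, hC0, hC⟩ := hφ.exists_bound
  have hI (g : E3 × E3 → ℝ) (hg : Measurable g) (hgb : ∀ q, |g q| ≤ C) :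
      Integrable (fun q : E3 × E3 => f q.1 * k q.2 * g q) (volume.prod volume) :=
    (hf.mul_prod hkt.integrable).mul_bdd (c := C) hg.aestronglyMeasurable
      (Eventually.of_forall hgb)
  have hI2 := hI (fun q => φ (q.1 - ε • q.2))
    (hφm.comp (measurable_fst.sub (measurable_snd.const_smul ε))) fun q => hC _
  have hI1 := hI (fun q => φ (q.1 + ε • q.2))
    (hφm.comp (measurable_fst.add (measurable_snd.const_smul ε))) fun q => hC _
  have hI0 : Integrable (fun q : E3 × E3 => k q.2 * f (q.1 - ε • q.2) * φ q.1)
      (volume.prod volume) := by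
    have hmp : MeasurePreserving (fun q : E3 × E3 => (q.1 - ε • q.2, q.2))
        (volume.prod volume) (volume.prod volume) := by
      have h := MeasurePreserving.skew_product (μa := (volume : Measure E3)) (μc := volume)
        (μb := (volume : Measure E3)) (μd := volume) (f := id)
        (g := fun z x => x - ε • z) (MeasurePreserving.id _) (by fun_prop)
        (Eventually.of_forall fun z => (measurePreserving_sub_right volume (ε • z)).map_eq)
      exact (Measure.measurePreserving_swap.comp h).comp Measure.measurePreserving_swap
    have := hmp.integrable_comp_of_integrable hI1
    refine this.congr (Eventually.of_forall fun q => ?_)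
    simp [mul_comm]
  calc ∫ x, avg k ε f x * φ x = ∫ x, ∫ z, k z * f (x - ε • z) * φ x := by
        simp only [avg, integral_mul_const]
    _ = ∫ z, ∫ x, k z * f (x - ε • z) * φ x := integral_integral_swap hI0
    _ = ∫ z, ∫ x, k z * f x * φ (x + ε • z) := by
        refine integral_congr_ae (Eventually.of_forall fun z => ?_)
        dsimp only
        rw [← integral_sub_right_eq_self (fun x => k z * f x * φ (x + ε • z)) (ε • z)]
        simp
    _ = ∫ z, ∫ x, k z * f x * φ (x - ε • z) := by
        rw [← integral_neg_eq_self]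
        simp [hk.even, sub_eq_add_neg]
    _ = ∫ x, ∫ z, k z * f x * φ (x - ε • z) := by
        rw [integral_integral_swap]
        refine hI2.swap.congr (Eventually.of_forall fun q => ?_)
        simp [Function.uncurry, mul_comm]
    _ = _ := by
        simp only [avg, ← integral_const_mul]
        refine integral_congr_ae (Eventually.of_forall fun x => ?_)
        refine integral_congr_ae (Eventually.of_forall fun z => ?_)
        dsimp only
        ring

/-! ### Sobolev limits of test functions -/

theorem norm_fderiv_le_sum (f : E3 → ℝ) (x : E3) : ‖fderiv ℝ f x‖ ≤ ∑ j, |pd j f x| := by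
  refine ContinuousLinearMap.opNorm_le_bound _ (Finset.sum_nonneg fun _ _ => abs_nonneg _)
    fun h => ?_
  rw [fderiv_apply_eq_sum, Real.norm_eq_abs, Finset.sum_mul]
  refine (Finset.abs_sum_le_sum_abs _ _).trans (Finset.sum_le_sum fun j _ => ?_)
  rw [abs_mul, mul_comm]
  exact mul_le_mul_of_nonneg_left (PiLp.norm_apply_le h j) (abs_nonneg _)

/-- The **Sobolev inequality** `‖φ‖_{L⁶} ≤ C ‖∇φ‖_{L²}` for test functions on `ℝ³`. -/
theorem exists_sobolev_const : ∃ C : NNReal, ∀ φ : E3 → ℝ, IsTest φ →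
    eLpNorm φ 6 volume ≤ C * ∑ j, eLpNorm (pd j φ) 2 volume := by
  refine ⟨SNormLESNormFDerivOfEqConst ℝ (volume : Measure E3) 2, fun φ hφ => ?_⟩
  have h := eLpNorm_le_eLpNorm_fderiv_of_eq (volume : Measure E3) (u := φ) (p := 2) (p' := 6)
    (hφ.smooth.of_le (by simp)) hφ.compact (by norm_num) (by simp) (by simp; norm_num)
  refine h.trans (mul_le_mul_right ?_ _)
  have hm (j : Fin 3) : AEStronglyMeasurable (fun x => |pd j φ x|) volume :=
    (hφ.pd j).continuous.abs.aestronglyMeasurable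
  calc eLpNorm (fderiv ℝ φ) 2 volume ≤ eLpNorm (∑ j, fun x => |pd j φ x|) 2 volume := by
        refine eLpNorm_mono_real fun x => ?_
        simpa using norm_fderiv_le_sum φ x
    _ ≤ ∑ j, eLpNorm (fun x => |pd j φ x|) 2 volume :=
        eLpNorm_sum_le (fun j _ => hm j) (by norm_num)
    _ = ∑ j, eLpNorm (pd j φ) 2 volume :=
        Finset.sum_congr rfl fun j _ => eLpNorm_norm (pd j φ)

/-- `f ∈ L⁶` is the limit of the test functions `φ n` in `L⁶`, and their partial derivatives
converge to the components `g j` in `L²`. This is how membership in `D₀^{1,2}` is used. -/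
structure IsSobolevLimit (φ : ℕ → E3 → ℝ) (f : E3 → ℝ) (g : Fin 3 → E3 → ℝ) : Prop where
  test : ∀ n, IsTest (φ n)
  tendsto : LpTendsto 6 φ f
  tendsto_pd : ∀ j, LpTendsto 2 (fun n => pd j (φ n)) (g j)

/-- A Cauchy sequence in `L^p` converges in `L^p`. -/
theorem exists_lpTendsto_of_cauchy {p : ℝ≥0∞} (hp : 1 ≤ p) {F : ℕ → E3 → ℝ}
    (hF : ∀ n, MemLp (F n) p volume)
    (hc : Tendsto (fun q : ℕ × ℕ => eLpNorm (fun x => F q.1 x - F q.2 x) p volume) atTop (𝓝 0)) :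
    ∃ f, LpTendsto p F f := by
  have : Fact (1 ≤ p) := ⟨hp⟩
  have h1 : CauchySeq fun n => (hF n).toLp (F n) := by
    rw [Lp.cauchySeq_Lp_iff_cauchySeq_eLpNorm]
    refine hc.congr fun q => eLpNorm_congr_ae ?_
    filter_upwards [(hF q.1).coeFn_toLp, (hF q.2).coeFn_toLp] with x h1 h2
    simp [h1, h2]
  obtain ⟨f, hf⟩ := cauchySeq_tendsto_of_complete h1
  rw [Lp.tendsto_Lp_iff_tendsto_eLpNorm'] at hf
  refine ⟨f, hF, Lp.memLp f, hf.congr fun n => eLpNorm_congr_ae ?_⟩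
  filter_upwards [(hF n).coeFn_toLp] with x h1
  simp [h1]

/-- The `L^p` limit and the `L¹_loc` limit of a sequence agree. -/
theorem ae_eq_of_tendsto_local {p : ℝ≥0∞} (hp : 1 ≤ p) {F : ℕ → E3 → ℝ} {f g : E3 → ℝ}
    (hF : LpTendsto p F f) (hg : AEStronglyMeasurable g)
    (hloc : ∀ K : Set E3, IsCompact K →
      Tendsto (fun n => eLpNorm (fun x => F n x - g x) 1 (volume.restrict K)) atTop (𝓝 0)) :
    f =ᵐ[volume] g := by
  have hball (R : ℕ) : f =ᵐ[volume.restrict (Metric.closedBall 0 R)] g := by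
    set K : Set E3 := Metric.closedBall 0 R
    have hK : IsCompact K := isCompact_closedBall 0 R
    have : IsFiniteMeasure (volume.restrict K) := ⟨by simpa using hK.measure_lt_top⟩
    have h0 : Tendsto (fun n => eLpNorm (fun x => F n x - f x) p (volume.restrict K)) atTop
        (𝓝 0) :=
      tendsto_of_tendsto_of_tendsto_of_le_of_le tendsto_const_nhds hF.tendsto
        (fun n => zero_le) fun n => eLpNorm_mono_measure _ Measure.restrict_le_self
    have h1 := tendstoInMeasure_of_tendsto_eLpNorm (zero_lt_one.trans_le hp).ne'
      (fun n => (hF.memLp n).1.restrict) hF.memLp_lim.1.restrict h0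
    have h2 := tendstoInMeasure_of_tendsto_eLpNorm one_ne_zero
      (fun n => (hF.memLp n).1.restrict) hg.restrict (hloc K hK)
    exact tendstoInMeasure_ae_unique h1 h2
  have hU : (⋃ R : ℕ, Metric.closedBall (0 : E3) R) = Set.univ := Metric.iUnion_closedBall_nat 0
  rw [← Measure.restrict_univ (μ := (volume : Measure E3)), ← hU]
  exact (ae_restrict_iUnion_iff _ _).2 hball

theorem pd_weakGradient_lpTendsto {q : ℝ≥0∞} {f : E3 → ℝ} (hf : MemD01 q f) :
    ∃ φ : ℕ → E3 → ℝ, (∀ n, IsTest (φ n)) ∧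
      (∀ j, LpTendsto q (fun n => pd j (φ n)) (fun x => weakGradient f x j)) ∧
      ∀ K : Set E3, IsCompact K →
        Tendsto (fun n => eLpNorm (fun x => φ n x - f x) 1 (volume.restrict K)) atTop (𝓝 0) := by
  obtain ⟨g, hg, hgq, φ, hφ, hgrad, hloc⟩ := hf
  have ht (n : ℕ) : IsTest (φ n) := ⟨(hφ n).1, (hφ n).2⟩
  refine ⟨φ, ht, fun j => ?_, hloc⟩
  have hgj : MemLp (fun x => g x j) q volume :=
    hgq.mono (by
      have := (EuclideanSpace.proj (𝕜 := ℝ) j).continuous.comp_aestronglyMeasurable hgq.1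
      exact this) (Eventually.of_forall fun x => PiLp.norm_apply_le (g x) j)
  have h1 : LpTendsto q (fun n => pd j (φ n)) (fun x => g x j) := by
    refine ⟨fun n => ((ht n).pd j).memLp q, hgj, ?_⟩
    refine tendsto_of_tendsto_of_tendsto_of_le_of_le tendsto_const_nhds hgrad
      (fun n => zero_le) fun n => eLpNorm_mono fun x => ?_
    have := PiLp.norm_apply_le (gradient (φ n) x - g x) j
    simpa [gradient_apply] using this
  refine h1.congr_lim ?_
  filter_upwards [hg.ae_eq hg.weakGradient] with x hx
  rw [hx]

/-- Functions in `D₀^{1,2}` are Sobolev limits of test functions. -/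
theorem exists_isSobolevLimit {f : E3 → ℝ} (hf : MemD01 2 f) :
    ∃ φ, IsSobolevLimit φ f fun j x => weakGradient f x j := by
  obtain ⟨φ, ht, hpd, hloc⟩ := pd_weakGradient_lpTendsto hf
  obtain ⟨C, hC⟩ := exists_sobolev_const
  have hfm : AEStronglyMeasurable f := by
    obtain ⟨g, hg, -⟩ := hf
    exact hg.locallyIntegrable_fun.aestronglyMeasurable
  have hcauchy (j : Fin 3) : Tendsto (fun q : ℕ × ℕ =>
      eLpNorm (pd j fun x => φ q.1 x - φ q.2 x) 2 volume) atTop (𝓝 0) := by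
    have h1 : Tendsto (fun q : ℕ × ℕ =>
        eLpNorm (fun x => pd j (φ q.1) x - weakGradient f x j) 2 volume
        + eLpNorm (fun x => pd j (φ q.2) x - weakGradient f x j) 2 volume) atTop (𝓝 0) := by
      rw [← prod_atTop_atTop_eq]
      simpa using ((hpd j).tendsto.comp tendsto_fst).add ((hpd j).tendsto.comp tendsto_snd)
    refine tendsto_of_tendsto_of_tendsto_of_le_of_le tendsto_const_nhds h1
      (fun n => zero_le) fun q => ?_
    refine le_trans (le_of_eq ?_) (eLpNorm_sub_le ((hpd j).sub_lim q.1).1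
      ((hpd j).sub_lim q.2).1 (by norm_num))
    refine congrArg (fun h => eLpNorm h _ volume) (funext fun x => ?_)
    rw [pd_sub ((ht _).differentiable x) ((ht _).differentiable x), Pi.sub_apply]
    ring
  have h6 : Tendsto (fun q : ℕ × ℕ => eLpNorm (fun x => φ q.1 x - φ q.2 x) 6 volume) atTop
      (𝓝 0) := by
    have h1 := ENNReal.Tendsto.const_mul (a := (C : ℝ≥0∞))
      (tendsto_finsetSum Finset.univ fun j _ => hcauchy j) (Or.inr (by simp))
    simp only [Finset.sum_const_zero, mul_zero] at h1
    exact tendsto_of_tendsto_of_tendsto_of_le_of_le tendsto_const_nhds h1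
      (fun n => zero_le) fun q => hC _ ((ht q.1).sub (ht q.2))
  obtain ⟨f', hf'⟩ := exists_lpTendsto_of_cauchy (by norm_num) (fun n => (ht n).memLp 6) h6
  exact ⟨φ, ht, hf'.congr_lim (ae_eq_of_tendsto_local (by norm_num) hf' hfm hloc), hpd⟩

namespace IsSobolevLimit

variable {φ : ℕ → E3 → ℝ} {f : E3 → ℝ} {g : Fin 3 → E3 → ℝ}

theorem congr_lim (h : IsSobolevLimit φ f g) {f' : E3 → ℝ} {g' : Fin 3 → E3 → ℝ}
    (hf : f =ᵐ[volume] f') (hg : ∀ j, g j =ᵐ[volume] g' j) : IsSobolevLimit φ f' g' :=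
  ⟨h.test, h.tendsto.congr_lim hf, fun j => (h.tendsto_pd j).congr_lim (hg j)⟩

theorem ae_eq_zero (h : IsSobolevLimit φ f g) (hg : ∀ j, g j =ᵐ[volume] 0) : f =ᵐ[volume] 0 := by
  obtain ⟨C, hC⟩ := exists_sobolev_const
  have h1 := ENNReal.Tendsto.const_mul (a := (C : ℝ≥0∞)) (tendsto_finsetSum Finset.univ
    fun j _ => (h.tendsto_pd j).tendsto_eLpNorm (by norm_num)) (Or.inr (by simp))
  simp only [eLpNorm_congr_ae (hg _), eLpNorm_zero, Finset.sum_const_zero, mul_zero] at h1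
  have h2 := h.tendsto.eLpNorm_le_of_tendsto (by norm_num) (fun n => hC _ (h.test n)) h1
  exact (eLpNorm_eq_zero_iff h.tendsto.memLp_lim.1 (by norm_num)).1 (le_antisymm h2 zero_le)

end IsSobolevLimit

/-! ### Difference quotients of Sobolev limits -/

/-- The mean oscillation at scale `ε` of `F` around `x`, with respect to a measure `ν` of
displacements. -/
def osc (ν : Measure E3) (ε : ℝ) (F : E3 → ℝ) (x : E3) : ℝ≥0∞ := ∫⁻ w, ‖F (x - ε • w) - F x‖ₑ ∂ν

/-- The uniform distribution on the segment from `0` to `z`. -/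
def segmentMeasure (z : E3) : Measure E3 :=
  (volume.restrict (Set.Icc (0 : ℝ) 1)).map fun s => s • z

instance (z : E3) : IsProbabilityMeasure (segmentMeasure z) := by
  have : IsProbabilityMeasure (volume.restrict (Set.Icc (0 : ℝ) 1)) := ⟨by simp⟩
  exact Measure.isProbabilityMeasure_map (by fun_prop)

theorem measurable_osc_integrand {F : E3 → ℝ} (hF : Measurable F) (ε : ℝ) (x : E3) :
    Measurable fun w => ‖F (x - ε • w) - F x‖ₑ :=
  ((hF.comp (measurable_const.sub (measurable_id.const_smul ε))).sub_const _).enorm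

theorem measurable_osc (ν : Measure E3) [IsFiniteMeasure ν] {F : E3 → ℝ} (hF : Measurable F)
    (ε : ℝ) : Measurable (osc ν ε F) :=
  Measurable.lintegral_prod_right' (f := fun q : E3 × E3 => ‖F (q.1 - ε • q.2) - F q.1‖ₑ)
    (((hF.comp (measurable_fst.sub (measurable_snd.const_smul ε))).sub
      (hF.comp measurable_fst)).enorm)

/-- The error of a difference quotient of a test function is the oscillation of its directional
derivative along the segment. -/
theorem IsTest.enorm_diffQuot_sub_le {φ : E3 → ℝ} (hφ : IsTest φ) (z : E3) {ε : ℝ} (hε : ε ≠ 0)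
    (x : E3) :
    ‖ε⁻¹ * (φ x - φ (x - ε • z)) - fderiv ℝ φ x z‖ₑ
      ≤ osc (segmentMeasure z) ε (fun y => fderiv ℝ φ y z) x := by
  set D : E3 → ℝ := fun y => fderiv ℝ φ y z with hD
  have hDc : Continuous D :=
    (hφ.smooth.continuous_fderiv (by simp)).clm_apply continuous_const
  have hderiv (s : ℝ) : HasDerivAt (fun s : ℝ => -φ (x - ε • (s • z))) (ε * D (x - ε • (s • z)))
      s := by
    have h1 : HasDerivAt (fun s : ℝ => x - ε • (s • z)) (-(ε • z)) s := by
      have := (((hasDerivAt_id s).smul_const z).const_smul ε).const_sub x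
      simpa using this
    have h2 := ((hφ.differentiable (x - ε • (s • z))).hasFDerivAt.comp_hasDerivAt s h1).fun_neg
    simpa [hD, Function.comp_def] using h2
  have hcont : Continuous fun s : ℝ => D (x - ε • (s • z)) := by fun_prop
  have hFTC := intervalIntegral.integral_eq_sub_of_hasDerivAt (a := 0) (b := 1)
    (fun s _ => hderiv s) ((hcont.const_mul ε).intervalIntegrable _ _)
  simp only [intervalIntegral.integral_const_mul, one_smul, zero_smul, smul_zero, sub_zero] at hFTC
  have e : ε⁻¹ * (φ x - φ (x - ε • z)) - D x = ∫ s in (0 : ℝ)..1, (D (x - ε • (s • z)) - D x) := by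
    rw [intervalIntegral.integral_sub (hcont.intervalIntegrable _ _)
      (continuous_const.intervalIntegrable _ _)]
    have : φ x - φ (x - ε • z) = ε * ∫ s in (0 : ℝ)..1, D (x - ε • (s • z)) := by
      rw [hFTC]; ring
    rw [this, inv_mul_cancel_left₀ hε]
    simp
  rw [e, intervalIntegral.integral_of_le zero_le_one, ← integral_Icc_eq_integral_Ioc, osc,
    segmentMeasure, lintegral_map (measurable_osc_integrand hDc.measurable ε x) (by fun_prop)]
  exact enorm_integral_le_lintegral_enorm _

theorem ENNReal_add_sq_le (a b : ℝ≥0∞) : (a + b) ^ (2 : ℝ) ≤ 2 * a ^ (2 : ℝ) + 2 * b ^ (2 : ℝ) := by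
  have h := ENNReal.rpow_add_le_mul_rpow_add_rpow a b (p := 2) (by norm_num)
  norm_num at h
  simpa [mul_add] using h

theorem osc_le_add (ν : Measure E3) [IsProbabilityMeasure ν] (ε : ℝ) {F F' : E3 → ℝ}
    (hF : Measurable F) (hF' : Measurable F') (x : E3) :
    osc ν ε F' x ≤ osc ν ε F x
      + ((∫⁻ w, ‖F' (x - ε • w) - F (x - ε • w)‖ₑ ∂ν) + ‖F' x - F x‖ₑ) := by
  have hm : Measurable fun w => ‖F' (x - ε • w) - F (x - ε • w)‖ₑ :=
    ((hF'.comp (measurable_const.sub (measurable_id.const_smul ε))).sub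
      (hF.comp (measurable_const.sub (measurable_id.const_smul ε)))).enorm
  have h1 : ‖F' x - F x‖ₑ = ∫⁻ _, ‖F' x - F x‖ₑ ∂ν := by simp
  rw [h1, osc, osc, ← lintegral_add_left hm,
    ← lintegral_add_left (measurable_osc_integrand hF ε x)]
  refine lintegral_mono fun w => ?_
  calc ‖F' (x - ε • w) - F' x‖ₑ
      = ‖(F (x - ε • w) - F x) + ((F' (x - ε • w) - F (x - ε • w)) - (F' x - F x))‖ₑ := by
        congr 1; ring
    _ ≤ _ := (enorm_add_le _ _).trans (by gcongr; exact enorm_sub_le)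

/-- Perturbing `F` changes its mean square oscillation by at most the `L²` distance. -/
theorem lintegral_osc_sq_le (ν : Measure E3) [IsProbabilityMeasure ν] (ε : ℝ) {F F' : E3 → ℝ}
    (hF : Measurable F) (hF' : Measurable F') :
    ∫⁻ x, osc ν ε F' x ^ (2 : ℝ) ≤ 2 * (∫⁻ x, osc ν ε F x ^ (2 : ℝ))
      + 8 * eLpNorm (fun x => F' x - F x) 2 volume ^ (2 : ℝ) := by
  have hd : Measurable fun x => F' x - F x := hF'.sub hF
  have h2 : ENNReal.ofReal 2 = 2 := by simp
  have hA := lintegral_average_translate_le ν one_le_two hd ε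
  have hB := eLpNorm_ofReal_rpow (f := fun x => F' x - F x) (p := 2) two_pos
  rw [h2] at hA hB
  rw [measure_univ, one_mul] at hA
  have hmA : Measurable fun x => ∫⁻ w, ‖F' (x - ε • w) - F (x - ε • w)‖ₑ ∂ν :=
    Measurable.lintegral_prod_right' (f := fun q : E3 × E3 =>
      ‖F' (q.1 - ε • q.2) - F (q.1 - ε • q.2)‖ₑ)
      (hd.comp (measurable_fst.sub (measurable_snd.const_smul ε))).enorm
  have hpt (x : E3) : osc ν ε F' x ^ (2 : ℝ) ≤ 2 * osc ν ε F x ^ (2 : ℝ)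
      + (4 * (∫⁻ w, ‖F' (x - ε • w) - F (x - ε • w)‖ₑ ∂ν) ^ (2 : ℝ)
        + 4 * ‖F' x - F x‖ₑ ^ (2 : ℝ)) := by
    refine (ENNReal.rpow_le_rpow (osc_le_add ν ε hF hF' x) (by norm_num)).trans ?_
    refine (ENNReal_add_sq_le _ _).trans ?_
    gcongr
    refine (mul_le_mul_right (ENNReal_add_sq_le _ _) 2).trans_eq ?_
    ring
  refine (lintegral_mono hpt).trans ?_
  rw [lintegral_add_left (((measurable_osc ν hF ε).pow_const _).const_mul _),
    lintegral_add_left ((hmA.pow_const _).const_mul _),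
    lintegral_const_mul _ ((measurable_osc ν hF ε).pow_const _),
    lintegral_const_mul _ (hmA.pow_const _), lintegral_const_mul _ (hd.enorm.pow_const _), ← hB]
  gcongr
  calc _ ≤ 4 * eLpNorm (fun x => F' x - F x) 2 volume ^ (2 : ℝ)
        + 4 * eLpNorm (fun x => F' x - F x) 2 volume ^ (2 : ℝ) := by gcongr
    _ = _ := by ring

namespace IsSobolevLimit

variable {φ : ℕ → E3 → ℝ} {f : E3 → ℝ} {g : Fin 3 → E3 → ℝ}

theorem tendsto_directional (h : IsSobolevLimit φ f g) (z : E3) :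
    LpTendsto 2 (fun n x => fderiv ℝ (φ n) x z) (fun x => ∑ j, z j * g j x) := by
  simp only [fderiv_apply_eq_sum]
  exact LpTendsto.sum (by norm_num) fun j => (h.tendsto_pd j).const_mul (z j)

/-- The `L²` error of a difference quotient of a Sobolev limit is controlled by the mean square
oscillation of the directional derivative. -/
theorem eLpNorm_diffQuot_sub_le (h : IsSobolevLimit φ f g) (hg : ∀ j, Measurable (g j)) (z : E3)
    {ε : ℝ} (hε : ε ≠ 0) :
    eLpNorm (fun x => ε⁻¹ * (f x - f (x - ε • z)) - ∑ j, z j * g j x) 2 volume ^ (2 : ℝ)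
      ≤ 2 * ∫⁻ x, osc (segmentMeasure z) ε (fun y => ∑ j, z j * g j y) x ^ (2 : ℝ) := by
  set F : E3 → ℝ := fun y => ∑ j, z j * g j y with hF
  have hFm : Measurable F := Finset.measurable_sum _ fun j _ => (hg j).const_mul _
  have hD := h.tendsto_directional z
  -- Along a subsequence both the functions and their directional derivatives converge almost
  -- everywhere, so the bound for test functions passes to the limit by Fatou's lemma.
  obtain ⟨k₁, hk₁, hae₁⟩ := h.tendsto.exists_subseq_ae (by norm_num)
  obtain ⟨k₂, hk₂, hae₂⟩ := (hD.comp_subseq hk₁.tendsto_atTop).exists_subseq_ae (by norm_num)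
  have hae₃ := (measurePreserving_sub_right (volume : Measure E3)
    (ε • z)).quasiMeasurePreserving.ae hae₁
  set ψ : ℕ → E3 → ℝ := fun n => φ (k₁ (k₂ n)) with hψ
  have hψt (n : ℕ) : IsTest (ψ n) := h.test _
  have hDc (n : ℕ) : Continuous fun x => fderiv ℝ (ψ n) x z :=
    ((hψt n).smooth.continuous_fderiv (by simp)).clm_apply continuous_const
  set Y : ℕ → E3 → ℝ := fun n x => ε⁻¹ * (ψ n x - ψ n (x - ε • z)) - fderiv ℝ (ψ n) x z with hY
  have hYae : ∀ᵐ x, Tendsto (fun n => Y n x) atTop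
      (𝓝 (ε⁻¹ * (f x - f (x - ε • z)) - F x)) := by
    filter_upwards [hae₁, hae₂, hae₃] with x h1 h2 h3
    exact (((h1.comp hk₂.tendsto_atTop).sub (h3.comp hk₂.tendsto_atTop)).const_mul _).sub h2
  have hYm (n : ℕ) : AEStronglyMeasurable (Y n) volume := by
    have := (hψt n).continuous
    have := hDc n
    exact Continuous.aestronglyMeasurable (by fun_prop)
  have hYn (n : ℕ) : eLpNorm (Y n) 2 volume ^ (2 : ℝ)
      ≤ 2 * (∫⁻ x, osc (segmentMeasure z) ε F x ^ (2 : ℝ))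
        + 8 * eLpNorm (fun x => fderiv ℝ (ψ n) x z - F x) 2 volume ^ (2 : ℝ) := by
    refine le_trans ?_ (lintegral_osc_sq_le (segmentMeasure z) ε hFm (hDc n).measurable)
    have h2 : ENNReal.ofReal 2 = 2 := by simp
    have h3 := eLpNorm_ofReal_rpow (f := Y n) two_pos
    rw [h2] at h3
    rw [h3]
    exact lintegral_mono fun x =>
      ENNReal.rpow_le_rpow ((hψt n).enorm_diffQuot_sub_le z hε x) (by norm_num)
  have hlim : Tendsto (fun n => 2 * (∫⁻ x, osc (segmentMeasure z) ε F x ^ (2 : ℝ))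
        + 8 * eLpNorm (fun x => fderiv ℝ (ψ n) x z - F x) 2 volume ^ (2 : ℝ)) atTop
      (𝓝 (2 * ∫⁻ x, osc (segmentMeasure z) ε F x ^ (2 : ℝ))) := by
    have h1 := (hD.comp_subseq hk₁.tendsto_atTop).comp_subseq hk₂.tendsto_atTop
    have h2 := (ENNReal.continuous_rpow_const (y := (2 : ℝ))).tendsto 0 |>.comp h1.tendsto
    rw [ENNReal.zero_rpow_of_pos (by norm_num)] at h2
    have h3 := ENNReal.Tendsto.const_mul (a := 8) h2 (Or.inr (by simp))
    have h4 := h3.const_add (2 * ∫⁻ x, osc (segmentMeasure z) ε F x ^ (2 : ℝ))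
    simpa [Function.comp_def, hψ] using h4
  have hle (n : ℕ) := (ENNReal.le_rpow_inv_iff (z := 2) (by norm_num)).2 (hYn n)
  have hlim' := (ENNReal.continuous_rpow_const (y := (2 : ℝ)⁻¹)).tendsto _ |>.comp hlim
  have hfin := Lp.eLpNorm_lim_le_liminf_eLpNorm hYm _ hYae (p := 2)
  rw [← ENNReal.le_rpow_inv_iff (by norm_num)]
  refine hfin.trans ?_
  rw [← hlim'.liminf_eq]
  exact liminf_le_liminf (Eventually.of_forall hle)

/-- Difference quotients of a Sobolev limit are bounded in `L²` by the directional derivative. The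
constant `5` is not sharp; what matters is that it does not depend on `ε`. -/
theorem eLpNorm_diffQuot_le (h : IsSobolevLimit φ f g) (hf : Measurable f)
    (hg : ∀ j, Measurable (g j)) (z : E3) {ε : ℝ} (hε : ε ≠ 0) :
    eLpNorm (fun x => ε⁻¹ * (f x - f (x - ε • z))) 2 volume
      ≤ 5 * eLpNorm (fun x => ∑ j, z j * g j x) 2 volume := by
  set F : E3 → ℝ := fun y => ∑ j, z j * g j y with hF
  have hFm : Measurable F := Finset.measurable_sum _ fun j _ => (hg j).const_mul _
  have h1 := h.eLpNorm_diffQuot_sub_le hg z hε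
  -- Comparison with the function `0`, which does not oscillate.
  have h2 := lintegral_osc_sq_le (segmentMeasure z) ε (measurable_const (a := (0 : ℝ))) hFm
  have h3 : ∫⁻ x, osc (segmentMeasure z) ε (fun _ => 0) x ^ (2 : ℝ) = 0 := by simp [osc]
  simp only [h3, sub_zero, mul_zero, zero_add] at h2
  have h4 : eLpNorm (fun x => ε⁻¹ * (f x - f (x - ε • z)) - F x) 2 volume
      ≤ 4 * eLpNorm F 2 volume := by
    rw [← ENNReal.rpow_le_rpow_iff (z := 2) (by norm_num),
      ENNReal.mul_rpow_of_nonneg _ _ (by norm_num)]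
    refine h1.trans ((mul_le_mul_right h2 2).trans_eq ?_)
    rw [← mul_assoc]
    norm_num
  have hm : Measurable fun x => ε⁻¹ * (f x - f (x - ε • z)) :=
    (hf.sub (hf.comp (measurable_id.sub_const _))).const_mul _
  calc _ = eLpNorm ((fun x => ε⁻¹ * (f x - f (x - ε • z)) - F x) + F) 2 volume := by
        refine congrArg (fun h => eLpNorm h _ volume) (funext fun x => ?_)
        simp
    _ ≤ 4 * eLpNorm F 2 volume + eLpNorm F 2 volume :=
        (eLpNorm_add_le (hm.sub hFm).aestronglyMeasurable hFm.aestronglyMeasurable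
          (by norm_num)).trans (add_le_add_left h4 _)
    _ = _ := by ring

/-- Difference quotients of a Sobolev limit converge in `L²` to the directional derivative. -/
theorem lpTendsto_diffQuot (h : IsSobolevLimit φ f g) (hf : Measurable f)
    (hg : ∀ j, Measurable (g j)) (z : E3) {ε : ℕ → ℝ} (hε : Tendsto ε atTop (𝓝 0))
    (hε0 : ∀ n, ε n ≠ 0) :
    LpTendsto 2 (fun n x => (ε n)⁻¹ * (f x - f (x - ε n • z))) (fun x => ∑ j, z j * g j x) := by
  have hFm : Measurable fun x => ∑ j, z j * g j x :=
    Finset.measurable_sum _ fun j _ => (hg j).const_mul _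
  have hFL := (h.tendsto_directional z).memLp_lim
  have hm (n : ℕ) : Measurable fun x => (ε n)⁻¹ * (f x - f (x - ε n • z)) :=
    (hf.sub (hf.comp (measurable_id.sub_const _))).const_mul _
  refine ⟨fun n => ⟨(hm n).aestronglyMeasurable, (h.eLpNorm_diffQuot_le hf hg z
    (hε0 n)).trans_lt (ENNReal.mul_lt_top (by simp) hFL.2)⟩, hFL, ?_⟩
  have h2 : ENNReal.ofReal 2 = 2 := by simp
  have h1 := tendsto_lintegral_oscillation (segmentMeasure z) one_le_two hFm
    (by rw [h2]; exact hFL) hε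
  have h3 := ENNReal.Tendsto.const_mul (a := 2) h1 (Or.inr (by simp))
  have h4 := (ENNReal.continuous_rpow_const (y := (2 : ℝ)⁻¹)).tendsto _ |>.comp h3
  rw [mul_zero, ENNReal.zero_rpow_of_pos (by norm_num)] at h4
  exact tendsto_of_tendsto_of_tendsto_of_le_of_le tendsto_const_nhds h4 (fun n => zero_le)
    fun n => (ENNReal.le_rpow_inv_iff (by norm_num)).2 (h.eLpNorm_diffQuot_sub_le hg z (hε0 n))

end IsSobolevLimit

/-! ### Square integrability from a bound on the distributional gradient -/

/-- The Laplacian. -/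
def lap (f : E3 → ℝ) (x : E3) : ℝ := ∑ i, pd i (pd i f) x

theorem IsTest.lap {ψ : E3 → ℝ} (h : IsTest ψ) : IsTest (lap ψ) :=
  IsTest.sum fun i => (h.pd i).pd i

theorem pd_comp_const_sub {f : E3 → ℝ} (hf : Differentiable ℝ f) (i : Fin 3) (x y : E3) :
    pd i (fun y => f (x - y)) y = -pd i f (x - y) := by
  have h := (hf (x - y)).hasFDerivAt.comp y ((hasFDerivAt_id y).const_sub x)
  have h' : fderiv ℝ (fun y => f (x - y)) y = _ := h.fderiv
  rw [pd, h', pd]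
  simp

theorem IsTest.comp_const_sub {k : E3 → ℝ} (hk : IsTest k) (x : E3) :
    IsTest fun y => k (x - y) :=
  ⟨hk.smooth.comp (contDiff_const.sub contDiff_id),
    hk.compact.comp_homeomorph (Homeomorph.subLeft x)⟩

theorem avg_eq_integral_scaled (k : E3 → ℝ) {ε : ℝ} (hε : ε ≠ 0) (f : E3 → ℝ) (x : E3) :
    avg k ε f x = ∫ y, f y * scaled k ε (x - y) := by
  rw [avg_eq_convolution k hε, convolution_eq_swap]
  simp [mul_comm]

theorem lap_avg {k : E3 → ℝ} (hk : IsTest k) {ε : ℝ} (hε : ε ≠ 0) {f : E3 → ℝ}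
    (hf : LocallyIntegrable f) (x : E3) :
    lap (avg k ε f) x = ∫ y, f y * lap (fun y => scaled k ε (x - y)) y := by
  have h1 (i : Fin 3) : pd i (avg k ε f) = fun x => ε⁻¹ * avg (pd i k) ε f x :=
    funext fun x => pd_avg hk hε hf i x
  have h2 (i : Fin 3) : pd i (scaled k ε) = fun x => ε⁻¹ * scaled (pd i k) ε x :=
    funext fun x => pd_scaled hk ε i x
  have h3 (i : Fin 3) (y : E3) : pd i (pd i fun y => scaled k ε (x - y)) y
      = ε⁻¹ * (ε⁻¹ * scaled (pd i (pd i k)) ε (x - y)) := by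
    have hs := hk.scaled hε
    have e : (pd i fun y => scaled k ε (x - y)) = fun y => -1 * pd i (scaled k ε) (x - y) :=
      funext fun y => by rw [pd_comp_const_sub hs.differentiable, neg_one_mul]
    rw [e, pd_const_mul (((hs.pd i).comp_const_sub x).differentiable y),
      pd_comp_const_sub (hs.pd i).differentiable, neg_one_mul, neg_neg, h2,
      pd_const_mul (((hk.pd i).scaled hε).differentiable _), pd_scaled (hk.pd i)]
  have hi (i : Fin 3) : Integrable fun y => f y * pd i (pd i fun y => scaled k ε (x - y)) y :=
    ((((hk.scaled hε).comp_const_sub x).pd i).pd i).locallyIntegrable_mul hf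
  simp only [lap, Finset.mul_sum]
  rw [integral_finsetSum _ fun i _ => hi i]
  refine Finset.sum_congr rfl fun i _ => ?_
  rw [h1, pd_const_mul ((contDiff_avg (hk.pd i) hε hf).differentiable (by simp) x),
    pd_avg (hk.pd i) hε hf, avg_eq_integral_scaled _ hε, ← integral_const_mul,
    ← integral_const_mul]
  refine integral_congr_ae (Eventually.of_forall fun y => ?_)
  dsimp only
  rw [h3]
  ring

theorem ofReal_two : ENNReal.ofReal 2 = 2 := by simp

/-- **Liouville's theorem** in `L²`: a weakly harmonic square integrable function vanishes. Its
mollifications and all their derivatives are in `L²`, so integration by parts shows that the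
gradients of the mollifications vanish. -/
theorem ae_eq_zero_of_harmonic {h : E3 → ℝ} (hm : Measurable h) (hL : MemLp h 2 volume)
    (hh : ∀ ψ, IsTest ψ → ∫ x, h x * lap ψ x = 0) : h =ᵐ[volume] 0 := by
  obtain ⟨k, hk⟩ := exists_isMollifier
  have hkt := hk.toIsTest
  have hloc : LocallyIntegrable h := hL.locallyIntegrable (by norm_num)
  have hzero {ε : ℝ} (hε : ε ≠ 0) : avg k ε h = 0 := by
    have hmem (K : E3 → ℝ) (hK : IsTest K) : MemLp (avg K ε h) 2 volume := by
      have := memLp_avg hK one_le_two ε hm (by rw [ofReal_two]; exact hL)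
      rwa [ofReal_two] at this
    have h1 (i : Fin 3) : pd i (avg k ε h) = fun x => ε⁻¹ * avg (pd i k) ε h x :=
      funext fun x => pd_avg hkt hε hloc i x
    have hd (K : E3 → ℝ) (hK : IsTest K) : ContDiff ℝ ∞ (avg K ε h) := contDiff_avg hK hε hloc
    have h2 (i : Fin 3) : pd i (pd i (avg k ε h)) = fun x =>
        ε⁻¹ * (ε⁻¹ * avg (pd i (pd i k)) ε h x) := by
      funext x
      rw [h1, pd_const_mul ((hd _ (hkt.pd i)).differentiable (by simp) x),
        pd_avg (hkt.pd i) hε hloc]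
    have hL1 (i : Fin 3) : MemLp (pd i (avg k ε h)) 2 volume := by
      rw [h1]; exact (hmem _ (hkt.pd i)).const_mul _
    have hL2 (i : Fin 3) : MemLp (pd i (pd i (avg k ε h))) 2 volume := by
      rw [h2]; exact ((hmem _ ((hkt.pd i).pd i)).const_mul _).const_mul _
    have hL0 := hmem k hkt
    have hdiff1 (i : Fin 3) : Differentiable ℝ (pd i (avg k ε h)) := by
      rw [h1]; exact ((hd _ (hkt.pd i)).differentiable (by simp)).const_mul _
    have hibp (i : Fin 3) : ∫ x, avg k ε h x * pd i (pd i (avg k ε h)) x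
        = -∫ x, pd i (avg k ε h) x * pd i (avg k ε h) x :=
      integral_mul_pd i ((hd k hkt).differentiable (by simp)) (hdiff1 i)
        (integrable_mul (p := 2) (q := 2) (hL1 i) (hL1 i))
        (integrable_mul (p := 2) (q := 2) hL0 (hL2 i))
        (integrable_mul (p := 2) (q := 2) hL0 (hL1 i))
    have hlap (x : E3) : lap (avg k ε h) x = 0 := by
      rw [lap_avg hkt hε hloc]
      exact hh _ ((hkt.scaled hε).comp_const_sub x)
    have hsum : ∑ i, ∫ x, pd i (avg k ε h) x * pd i (avg k ε h) x = 0 := by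
      have e : ∑ i, ∫ x, avg k ε h x * pd i (pd i (avg k ε h)) x = 0 := by
        rw [← integral_finsetSum _ fun i _ => integrable_mul (p := 2) (q := 2) hL0 (hL2 i)]
        simp_rw [← Finset.mul_sum]
        have : ∀ x, avg k ε h x * ∑ i, pd i (pd i (avg k ε h)) x = 0 := fun x => by
          have := hlap x
          rw [lap] at this
          rw [this, mul_zero]
        simp [this]
      simpa [hibp] using e
    have hpd (i : Fin 3) (x : E3) : pd i (avg k ε h) x = 0 := by
      have h3 := (Finset.sum_eq_zero_iff_of_nonneg fun i _ =>
        integral_nonneg fun x => mul_self_nonneg (pd i (avg k ε h) x)).1 hsum i (Finset.mem_univ i)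
      rw [integral_eq_zero_iff_of_nonneg (fun x => mul_self_nonneg _)
        (integrable_mul (p := 2) (q := 2) (hL1 i) (hL1 i))] at h3
      have hc := (hdiff1 i).continuous
      have h4 := (Continuous.ae_eq_iff_eq volume (hc.mul hc) continuous_const).1 h3
      exact mul_self_eq_zero.1 (congrFun h4 x)
    have hconst (x : E3) : avg k ε h x = avg k ε h 0 := by
      refine is_const_of_fderiv_eq_zero ((hd k hkt).differentiable (by simp)) (fun x => ?_) x 0
      ext v
      rw [fderiv_apply_eq_sum]
      simp [hpd]
    have hc : avg k ε h = fun _ => avg k ε h 0 := funext hconst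
    rw [hc, memLp_const_iff (by norm_num) (by norm_num)] at hL0
    have h0 : avg k ε h 0 = 0 := by
      rcases hL0 with h | h
      · exact h
      · simp at h
    rw [hc, h0]
    rfl
  have hε : Tendsto (fun n : ℕ => 1 / ((n : ℝ) + 1)) atTop (𝓝 0) :=
    tendsto_one_div_add_atTop_nhds_zero_nat
  have hε0 (n : ℕ) : 1 / ((n : ℝ) + 1) ≠ 0 := by positivity
  have ht := hk.lpTendsto_avg one_le_two hm (by rw [ofReal_two]; exact hL) hε hε0
  have h5 := ht.tendsto
  simp only [hzero (hε0 _), ofReal_two, Pi.zero_apply, zero_sub] at h5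
  have h6 := tendsto_nhds_unique h5 tendsto_const_nhds
  have h7 : eLpNorm h 2 volume = 0 := by
    rw [← eLpNorm_neg]; exact h6.symm
  exact (eLpNorm_eq_zero_iff hL.1 (by norm_num)).1 h7

/-- The Laplacians of test functions are dense in `L²`, so they detect the norm. -/
theorem eLpNorm_le_of_forall_lap {f : E3 → ℝ} (hf : MemLp f 2 volume) {C : ℝ} (hC0 : 0 ≤ C)
    (hC : ∀ ψ, IsTest ψ → |∫ x, f x * lap ψ x| ≤ C * (eLpNorm (lap ψ) 2 volume).toReal) :
    eLpNorm f 2 volume ≤ ENNReal.ofReal C := by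
  let K : Submodule ℝ (Lp ℝ 2 (volume : Measure E3)) :=
    { carrier := {v | ∃ ψ, IsTest ψ ∧ v =ᵐ[volume] lap ψ}
      add_mem' := by
        rintro v w ⟨ψ, hψ, hv⟩ ⟨χ, hχ, hw⟩
        refine ⟨fun x => ψ x + χ x, hψ.add hχ, ?_⟩
        filter_upwards [Lp.coeFn_add v w, hv, hw] with x h1 h2 h3
        have h4 (i : Fin 3) : (pd i fun x => ψ x + χ x) = fun x => pd i ψ x + pd i χ x := by
          funext x
          simp [pd, fderiv_fun_add (hψ.differentiable x) (hχ.differentiable x)]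
        have h5 (i : Fin 3) : pd i (fun x => pd i ψ x + pd i χ x) x
            = pd i (pd i ψ) x + pd i (pd i χ) x := by
          rw [pd, fderiv_fun_add ((hψ.pd i).differentiable x) ((hχ.pd i).differentiable x)]
          rfl
        rw [h1, Pi.add_apply, h2, h3]
        simp only [lap, h4, h5, Finset.sum_add_distrib]
      zero_mem' := by
        refine ⟨fun _ => 0, ⟨contDiff_const, HasCompactSupport.zero⟩, ?_⟩
        filter_upwards [Lp.coeFn_zero ℝ 2 (volume : Measure E3)] with x hx
        have h4 (i : Fin 3) : (pd i fun _ => (0 : ℝ)) = fun _ => 0 := by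
          funext x; simp [pd]
        simp [lap, h4]
      smul_mem' := by
        rintro c v ⟨ψ, hψ, hv⟩
        refine ⟨fun x => c * ψ x, hψ.const_mul c, ?_⟩
        filter_upwards [Lp.coeFn_smul c v, hv] with x h1 h2
        have h4 (i : Fin 3) : (pd i fun x => c * ψ x) = fun x => c * pd i ψ x := by
          funext x
          exact pd_const_mul (hψ.differentiable x) c i
        rw [h1, Pi.smul_apply, h2]
        simp only [lap, h4, smul_eq_mul, Finset.mul_sum]
        exact Finset.sum_congr rfl fun i _ =>
          (pd_const_mul ((hψ.pd i).differentiable x) c i).symm }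
  have hinner (v : Lp ℝ 2 (volume : Measure E3)) (ψ : E3 → ℝ) (hv : v =ᵐ[volume] lap ψ)
      (w : Lp ℝ 2 (volume : Measure E3)) : inner ℝ v w = ∫ x, w x * lap ψ x := by
    rw [L2.inner_def]
    refine integral_congr_ae ?_
    filter_upwards [hv] with x hx
    simp [hx]
  have hK : K.topologicalClosure = ⊤ := by
    rw [Submodule.topologicalClosure_eq_top_iff, Submodule.eq_bot_iff]
    intro w hw
    rw [Submodule.mem_orthogonal] at hw
    have h0 := ae_eq_zero_of_harmonic (Lp.stronglyMeasurable w).measurable (Lp.memLp w) ?_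
    · exact (Lp.eq_zero_iff_ae_eq_zero).2 h0
    · intro ψ hψ
      have hv := (hψ.lap.memLp 2).coeFn_toLp
      rw [← hinner _ ψ hv w]
      exact hw _ ⟨ψ, hψ, hv⟩
  set v := hf.toLp f with hvdef
  have hle (w : Lp ℝ 2 (volume : Measure E3)) : |inner ℝ w v| ≤ C * ‖w‖ := by
    have hcl : IsClosed {w : Lp ℝ 2 (volume : Measure E3) | |inner ℝ w v| ≤ C * ‖w‖} :=
      isClosed_le (by fun_prop) (by fun_prop)
    have hsub : (K : Set (Lp ℝ 2 (volume : Measure E3))) ⊆ {w | |inner ℝ w v| ≤ C * ‖w‖} := by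
      rintro w ⟨ψ, hψ, hw⟩
      change |inner ℝ w v| ≤ C * ‖w‖
      rw [hinner w ψ hw v, Lp.norm_def, eLpNorm_congr_ae hw]
      refine le_of_eq_of_le (congrArg _ (integral_congr_ae ?_)) (hC ψ hψ)
      filter_upwards [hf.coeFn_toLp] with x hx
      rw [hvdef, hx]
    have hmem : w ∈ K.topologicalClosure := by rw [hK]; trivial
    exact closure_minimal hsub hcl hmem
  have h1 := hle v
  rw [real_inner_self_eq_norm_sq, abs_of_nonneg (by positivity)] at h1
  have h2 : ‖v‖ ≤ C := by
    rcases (norm_nonneg v).eq_or_lt with h | h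
    · rwa [← h]
    · nlinarith
  rw [hvdef, Lp.norm_toLp] at h2
  exact (ENNReal.le_ofReal_iff_toReal_le hf.2.ne hC0).2 h2

/-- An integrable function is square integrable as soon as its pairings with Laplacians of test
functions are bounded in `L²`: its mollifications satisfy the same bound. -/
theorem memLp_two_of_forall_lap {P : E3 → ℝ} (hm : Measurable P) (hP : Integrable P) {C : ℝ}
    (hC0 : 0 ≤ C)
    (hC : ∀ ψ, IsTest ψ → |∫ x, P x * lap ψ x| ≤ C * (eLpNorm (lap ψ) 2 volume).toReal) :
    MemLp P 2 volume := by
  obtain ⟨k, hk⟩ := exists_isMollifier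
  have hkt := hk.toIsTest
  have := isFiniteMeasure_weight hkt
  have hε : Tendsto (fun n : ℕ => 1 / ((n : ℝ) + 1)) atTop (𝓝 0) :=
    tendsto_one_div_add_atTop_nhds_zero_nat
  have hε0 : ∀ n, (fun n : ℕ => 1 / ((n : ℝ) + 1)) n ≠ 0 := fun n => by positivity
  generalize (fun n : ℕ => 1 / ((n : ℝ) + 1)) = ε at hε hε0
  have hP1 : MemLp P (ENNReal.ofReal 1) volume := by
    rw [ENNReal.ofReal_one]; exact memLp_one_iff_integrable.2 hP
  have ht := hk.lpTendsto_avg le_rfl hm hP1 hε hε0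
  set W : ℝ := (weight k Set.univ).toReal with hW
  have hL2 (n : ℕ) : MemLp (avg k (ε n) P) 2 volume := by
    obtain ⟨B, hB⟩ := exists_bound_avg hkt (hε0 n) hP
    have h1 : Integrable (avg k (ε n) P) := by
      have := ht.memLp n
      rw [ENNReal.ofReal_one] at this
      exact memLp_one_iff_integrable.1 this
    rw [memLp_two_iff_integrable_sq h1.1]
    simp only [sq]
    exact h1.mul_bdd (c := B) h1.1 (Eventually.of_forall hB)
  have hbd (n : ℕ) : eLpNorm (avg k (ε n) P) 2 volume ≤ ENNReal.ofReal (C * W) := by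
    refine eLpNorm_le_of_forall_lap (hL2 n) (by positivity) fun ψ hψ => ?_
    have e : lap (avg k (ε n) ψ) = avg k (ε n) (lap ψ) := by
      funext x
      have h1 (i : Fin 3) : pd i (avg k (ε n) ψ) = avg k (ε n) (pd i ψ) :=
        funext fun x => hkt.pd_avg hψ (hε0 n) i x
      have h2 (i : Fin 3) : pd i (avg k (ε n) (pd i ψ)) x = avg k (ε n) (pd i (pd i ψ)) x :=
        hkt.pd_avg (hψ.pd i) (hε0 n) i x
      simp only [lap, h1, h2]
      simp only [avg, lap, Finset.mul_sum]
      rw [integral_finsetSum _ fun i _ => integrable_mul_translate hkt (hε0 n)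
        ((hψ.pd i).pd i).continuous.locallyIntegrable x]
    rw [hk.integral_avg_mul _ hP hψ.lap, ← e]
    refine (hC _ (hkt.avg hψ (hε0 n))).trans ?_
    rw [mul_assoc]
    refine mul_le_mul_of_nonneg_left ?_ hC0
    rw [hW, ← ENNReal.toReal_mul]
    refine ENNReal.toReal_mono (ENNReal.mul_ne_top (measure_ne_top _ _) (hψ.lap.memLp 2).2.ne) ?_
    rw [e]
    have := eLpNorm_avg_le hkt one_le_two (ε n) hψ.lap.continuous.measurable
    rwa [ofReal_two] at this
  exact ⟨hP.1, (ht.eLpNorm_le_of_tendsto (by simp) hbd tendsto_const_nhds).trans_lt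
    ENNReal.ofReal_lt_top⟩

/-- The Hessian of a test function is controlled in `L²` by its Laplacian. -/
theorem eLpNorm_hessian_le {ψ : E3 → ℝ} (hψ : IsTest ψ) (i j : Fin 3) :
    eLpNorm (pd j (pd i ψ)) 2 volume
      ≤ eLpNorm (lap ψ) 2 volume := by
  have h2 (i j : Fin 3) := ((hψ.pd i).pd j).memLp 2
  have hii (a b c d : Fin 3) := integrable_mul (p := 2) (q := 2) (h2 a b) (h2 c d)
  have hcomm (i j : Fin 3) (x : E3) : pd i (pd j ψ) x
      = pd j (pd i ψ) x :=
    pd_comm (hψ.smooth.of_le (by norm_cast)) i j x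
  have key (i j : Fin 3) :
      ∫ x, pd j (pd i ψ) x * pd j (pd i ψ) x
      = ∫ x, pd i (pd i ψ) x
          * pd j (pd j ψ) x := by
    rw [← (hψ.pd i).integral_pd_mul_pd_comm (hψ.pd j) j i]
    simp only [hcomm i j]
  have hsum : ∑ i, ∑ j,
      ∫ x, pd j (pd i ψ) x * pd j (pd i ψ) x
      = ∫ x, lap ψ x * lap ψ x := by
    simp only [key, lap, Finset.sum_mul_sum]
    rw [integral_finsetSum _ fun i _ => integrable_finsetSum _ fun j _ => hii i i j j]
    refine Finset.sum_congr rfl fun i _ => ?_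
    rw [integral_finsetSum _ fun j _ => hii i i j j]
  have hle : ∫ x, pd j (pd i ψ) x
        * pd j (pd i ψ) x
      ≤ ∫ x, lap ψ x * lap ψ x := by
    rw [← hsum]
    have hnn (i j : Fin 3) : 0 ≤ ∫ x, pd j (pd i ψ) x * pd j (pd i ψ) x :=
      integral_nonneg fun x => mul_self_nonneg _
    exact (Finset.single_le_sum (fun j _ => hnn i j) (Finset.mem_univ j)).trans
      (Finset.single_le_sum (f := fun i => ∑ j, ∫ x, pd j (pd i ψ) x
        * pd j (pd i ψ) x)
        (fun i _ => Finset.sum_nonneg fun j _ => hnn i j) (Finset.mem_univ i))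
  have hsq {F : E3 → ℝ} (hF : MemLp F 2 volume) :
      eLpNorm F 2 volume ^ (2 : ℝ) = ENNReal.ofReal (∫ x, F x * F x) := by
    have h := eLpNorm_ofReal_rpow (f := F) two_pos
    rw [ofReal_two] at h
    rw [h, ofReal_integral_eq_lintegral_ofReal (integrable_mul (p := 2) (q := 2) hF hF)
      (Eventually.of_forall fun x => mul_self_nonneg _)]
    refine lintegral_congr fun x => ?_
    rw [← ofReal_norm, ENNReal.ofReal_rpow_of_nonneg (norm_nonneg _) (by norm_num)]
    simp [sq]
  rw [← ENNReal.rpow_le_rpow_iff (z := 2) (by norm_num), hsq (h2 i j), hsq (hψ.lap.memLp 2)]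
  exact ENNReal.ofReal_le_ofReal hle

instance holderConjugate_six : ENNReal.HolderConjugate (ENNReal.ofReal (6 / 5)) 6 := by
  have := holderTriple_ofReal (a := 6 / 5) (b := 6) (c := 1) (by norm_num) (by norm_num)
    one_pos (by norm_num)
  simpa using this

/-- An integrable function whose gradient is the sum of a divergence of `L²` fields and of an
`L^{6/5}` field is square integrable. -/
theorem memLp_two_of_gradient {P : E3 → ℝ} (hm : Measurable P) (hP : Integrable P)
    {A : Fin 3 → Fin 3 → E3 → ℝ} (hA : ∀ i j, MemLp (A i j) 2 volume)
    {b : Fin 3 → E3 → ℝ} (hb : ∀ i, MemLp (b i) (ENNReal.ofReal (6 / 5)) volume)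
    (h : ∀ ψ, IsTest ψ → ∫ x, P x * lap ψ x
      = (∑ i, ∑ j, ∫ x, A i j x * pd j (pd i ψ) x) + ∑ i, ∫ x, b i x * pd i ψ x) :
    MemLp P 2 volume := by
  obtain ⟨S, hS⟩ := exists_sobolev_const
  refine memLp_two_of_forall_lap (C := (∑ i, ∑ j, (eLpNorm (A i j) 2 volume).toReal)
    + ∑ i, (eLpNorm (b i) (ENNReal.ofReal (6 / 5)) volume).toReal * (3 * S)) hm hP
    (by positivity) fun ψ hψ => ?_
  set N := (eLpNorm (lap ψ) 2 volume).toReal with hN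
  have hNtop : eLpNorm (lap ψ) 2 volume ≠ ⊤ := (hψ.lap.memLp 2).2.ne
  have h6 (i : Fin 3) : (eLpNorm (pd i ψ) 6 volume).toReal ≤ 3 * S * N := by
    have h1 : eLpNorm (pd i ψ) 6 volume ≤ S * (3 * eLpNorm (lap ψ) 2 volume) := by
      refine (hS _ (hψ.pd i)).trans (mul_le_mul_right ?_ _)
      refine (Finset.sum_le_sum fun j _ => eLpNorm_hessian_le hψ i j).trans_eq ?_
      simp
    have h2 := ENNReal.toReal_mono (by
      exact ENNReal.mul_ne_top (by simp) (ENNReal.mul_ne_top (by simp) hNtop)) h1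
    simp only [ENNReal.toReal_mul, ENNReal.toReal_ofNat, ENNReal.coe_toReal] at h2
    refine h2.trans_eq ?_
    ring
  rw [h ψ hψ, add_mul]
  refine (abs_add_le _ _).trans (add_le_add ?_ ?_)
  · rw [Finset.sum_mul]
    refine (Finset.abs_sum_le_sum_abs _ _).trans (Finset.sum_le_sum fun i _ => ?_)
    rw [Finset.sum_mul]
    refine (Finset.abs_sum_le_sum_abs _ _).trans (Finset.sum_le_sum fun j _ => ?_)
    refine (abs_integral_mul_le (p := 2) (q := 2) (hA i j) (((hψ.pd i).pd j).memLp 2)).trans ?_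
    gcongr
    exact ENNReal.toReal_mono hNtop (eLpNorm_hessian_le hψ i j)
  · rw [Finset.sum_mul]
    refine (Finset.abs_sum_le_sum_abs _ _).trans (Finset.sum_le_sum fun i _ => ?_)
    refine (abs_integral_mul_le (p := ENNReal.ofReal (6 / 5)) (q := 6) (hb i)
      ((hψ.pd i).memLp 6)).trans ?_
    rw [mul_assoc]
    gcongr
    exact h6 i

/-! ### Powers in Lebesgue spaces -/

theorem abs_rpow_sub_rpow_le {s a b : ℝ} (hs : 1 ≤ s) (ha : 0 ≤ a) (hb : 0 ≤ b) :
    |a ^ s - b ^ s| ≤ s * (|a - b| * (a + b) ^ (s - 1)) := by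
  have hmem {x y : ℝ} (hx : 0 ≤ x) (hy : 0 ≤ y) : x ∈ Set.Icc 0 (x + y) := ⟨hx, by linarith⟩
  have h := Convex.norm_image_sub_le_of_norm_hasDerivWithin_le (f := fun x : ℝ => x ^ s)
    (f' := fun x => s * x ^ (s - 1)) (s := Set.Icc 0 (a + b)) (x := b) (y := a)
    (C := s * (a + b) ^ (s - 1))
    (fun x _ => (Real.hasDerivAt_rpow_const (Or.inr hs)).hasDerivWithinAt) (fun x hx => by
      rw [Real.norm_of_nonneg (mul_nonneg (by linarith) (Real.rpow_nonneg hx.1 _))]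
      exact mul_le_mul_of_nonneg_left (Real.rpow_le_rpow hx.1 hx.2 (by linarith)) (by linarith))
    (convex_Icc _ _) (by rw [add_comm]; exact hmem hb ha) (hmem ha hb)
  rw [Real.norm_eq_abs, Real.norm_eq_abs] at h
  refine h.trans_eq ?_
  ring

theorem memLp_rpow {p s : ℝ} (hp : 0 < p) (hs : 0 < s) {f : E3 → ℝ} (hf0 : ∀ x, 0 ≤ f x)
    (hf : MemLp f (ENNReal.ofReal p) volume) :
    MemLp (fun x => f x ^ s) (ENNReal.ofReal (p / s)) volume := by
  have hm : AEStronglyMeasurable (fun x => f x ^ s) volume :=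
    (hf.1.aemeasurable.pow_const s).aestronglyMeasurable
  rw [memLp_ofReal_iff (by positivity) hm]
  rw [memLp_ofReal_iff hp hf.1] at hf
  refine hf.congr (Eventually.of_forall fun x => ?_)
  dsimp only
  rw [abs_of_nonneg (hf0 x), abs_of_nonneg (Real.rpow_nonneg (hf0 x) _), ← Real.rpow_mul (hf0 x),
    mul_div_cancel₀ _ hs.ne']

/-- `f ↦ f^s` is continuous from the nonnegative cone of `L^p` to `L^{p/s}`. -/
theorem LpTendsto.rpow {p s : ℝ} (hp : 1 ≤ p) (hs : 1 < s) {F : ℕ → E3 → ℝ} {f : E3 → ℝ}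
    (hF : LpTendsto (ENNReal.ofReal p) F f) (hF0 : ∀ n x, 0 ≤ F n x) (hf0 : ∀ x, 0 ≤ f x) :
    LpTendsto (ENNReal.ofReal (p / s)) (fun n x => F n x ^ s) (fun x => f x ^ s) := by
  have hp0 : 0 < p := by linarith
  have hs0 : 0 < s := by linarith
  have hs1 : 0 < s - 1 := by linarith
  refine ⟨fun n => memLp_rpow hp0 hs0 (hF0 n) (hF.memLp n), memLp_rpow hp0 hs0 hf0 hF.memLp_lim, ?_⟩
  have := holderTriple_ofReal (a := p) (b := p / (s - 1)) (c := p / s) hp0 (by positivity)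
    (by positivity) (by field_simp; ring)
  have hsum := hF.add (ENNReal.one_le_ofReal.2 hp) (LpTendsto.const hF.memLp_lim)
  have hpow (n : ℕ) : eLpNorm (fun x => (F n x + f x) ^ (s - 1)) (ENNReal.ofReal (p / (s - 1)))
      volume = eLpNorm (fun x => F n x + f x) (ENNReal.ofReal p) volume ^ (s - 1) := by
    have h := eLpNorm_norm_rpow (μ := (volume : Measure E3)) (p := ENNReal.ofReal (p / (s - 1)))
      (fun x => F n x + f x) hs1
    rw [← ENNReal.ofReal_mul (by positivity), div_mul_cancel₀ _ hs1.ne'] at h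
    rw [← h]
    refine congrArg (fun h => eLpNorm h _ volume) (funext fun x => ?_)
    rw [Real.norm_of_nonneg (add_nonneg (hF0 n x) (hf0 x))]
  have h0 : Tendsto (fun n => ‖s‖ₑ * (eLpNorm (fun x => F n x - f x) (ENNReal.ofReal p) volume
      * eLpNorm (fun x => F n x + f x) (ENNReal.ofReal p) volume ^ (s - 1))) atTop (𝓝 0) := by
    have h1 := ((ENNReal.continuous_rpow_const (y := s - 1)).tendsto _).comp
      (hsum.tendsto_eLpNorm (ENNReal.one_le_ofReal.2 hp))
    have h2 := ENNReal.Tendsto.mul hF.tendsto (Or.inr (ENNReal.rpow_ne_top_of_nonneg hs1.le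
      hsum.memLp_lim.2.ne)) h1 (Or.inr ENNReal.zero_ne_top)
    have h3 := ENNReal.Tendsto.const_mul (a := ‖s‖ₑ) h2 (Or.inr (by simp))
    simpa using h3
  refine tendsto_of_tendsto_of_tendsto_of_le_of_le tendsto_const_nhds h0 (fun n => zero_le)
    fun n => ?_
  calc _ ≤ eLpNorm (s • fun x => (F n x - f x) * (F n x + f x) ^ (s - 1))
        (ENNReal.ofReal (p / s)) volume := by
        refine eLpNorm_mono fun x => ?_
        rw [Pi.smul_apply, smul_eq_mul, norm_mul, norm_mul, Real.norm_of_nonneg hs0.le,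
          Real.norm_of_nonneg (Real.rpow_nonneg (add_nonneg (hF0 n x) (hf0 x)) _)]
        exact abs_rpow_sub_rpow_le hs.le (hF0 n x) (hf0 x)
    _ = ‖s‖ₑ * eLpNorm (fun x => (F n x - f x) * (F n x + f x) ^ (s - 1))
        (ENNReal.ofReal (p / s)) volume := eLpNorm_const_smul _ _ _ _
    _ ≤ _ := by
        rw [← hpow]
        gcongr
        exact eLpNorm_mul_le (hF.sub_lim n).1
          ((hsum.memLp n).1.aemeasurable.pow_const _).aestronglyMeasurable

theorem LpTendsto.exists_bound {p : ℝ≥0∞} (hp : 1 ≤ p) {F : ℕ → E3 → ℝ} {f : E3 → ℝ}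
    (hF : LpTendsto p F f) : ∃ B : ℝ, 0 ≤ B ∧ ∀ n, (eLpNorm (F n) p volume).toReal ≤ B := by
  have h := (ENNReal.tendsto_toReal hF.memLp_lim.2.ne).comp (hF.tendsto_eLpNorm hp)
  obtain ⟨B, hB⟩ := h.bddAbove_range
  have hB' (n : ℕ) : (eLpNorm (F n) p volume).toReal ≤ B := hB ⟨n, rfl⟩
  exact ⟨B, ENNReal.toReal_nonneg.trans (hB' 0), hB'⟩

/-! ### The renormalized continuity equation -/

/-- The first moments of `∇k`, which produce the divergence in the limit of the commutators. -/
theorem integral_pd_mul_coord {k : E3 → ℝ} (hk : IsMollifier k) (i j : Fin 3) :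
    ∫ z : E3, pd j k z * z i = if i = j then -1 else 0 := by
  have hc : ContDiff ℝ 1 fun z : E3 => z i := (EuclideanSpace.proj (𝕜 := ℝ) i).contDiff
  have hd (z : E3) : pd j (fun z : E3 => z i) z = if i = j then 1 else 0 := by
    have h : fderiv ℝ (fun z : E3 => z i) z = EuclideanSpace.proj (𝕜 := ℝ) i :=
      (EuclideanSpace.proj (𝕜 := ℝ) i).fderiv
    rw [pd, h]
    simp
  have h := hk.toIsTest.integral_mul_pd hc j
  simp only [mul_comm (pd j k _)]
  rw [h]
  simp only [hd, ite_mul, one_mul, zero_mul]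
  split_ifs
  · rw [hk.integral_eq_one]
  · simp

/-- The **commutator identity**: for a solution of `div (ρu) = 0`, the transport of the mollified
density is an average of difference quotients of the velocity. -/
theorem sum_mul_pd_avg {k : E3 → ℝ} (hk : IsTest k) {ε : ℝ} (hε : ε ≠ 0) {ρ : E3 → ℝ}
    {u : Fin 3 → E3 → ℝ} (hρ : LocallyIntegrable ρ)
    (hρu : ∀ j, LocallyIntegrable fun x => ρ x * u j x)
    (hcont : ∀ ψ, IsTest ψ → ∑ j, ∫ x, ρ x * u j x * pd j ψ x = 0) (x : E3) :
    ∑ j, u j x * pd j (avg k ε ρ) x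
      = ∑ j, ∫ z, pd j k z * (ρ (x - ε • z) * (ε⁻¹ * (u j x - u j (x - ε • z)))) := by
  have h1 (j : Fin 3) : ∫ z, pd j k z * (ρ (x - ε • z) * (ε⁻¹ * (u j x - u j (x - ε • z))))
      = u j x * pd j (avg k ε ρ) x - ε⁻¹ * avg (pd j k) ε (fun y => ρ y * u j y) x := by
    have hi1 := (integrable_mul_translate (hk.pd j) hε hρ x).const_mul (u j x * ε⁻¹)
    have hi2 := (integrable_mul_translate (hk.pd j) hε (hρu j) x).const_mul ε⁻¹
    rw [pd_avg hk hε hρ, avg, avg, ← mul_assoc, ← integral_const_mul, ← integral_const_mul,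
      ← integral_sub hi1 hi2]
    refine integral_congr_ae (Eventually.of_forall fun z => ?_)
    dsimp only
    ring
  have h2 : ∑ j, ε⁻¹ * avg (pd j k) ε (fun y => ρ y * u j y) x = 0 := by
    have hs := hk.scaled hε
    have h3 := hcont _ (hs.comp_const_sub x)
    have h4 (j : Fin 3) : ε⁻¹ * avg (pd j k) ε (fun y => ρ y * u j y) x
        = -∫ y, ρ y * u j y * pd j (fun y => scaled k ε (x - y)) y := by
      rw [avg_eq_integral_scaled _ hε, ← integral_const_mul, ← integral_neg]
      refine integral_congr_ae (Eventually.of_forall fun y => ?_)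
      dsimp only
      rw [pd_comp_const_sub hs.differentiable, pd_scaled hk]
      ring
    simp only [h4, Finset.sum_neg_distrib, h3, neg_zero]
  simp only [h1, Finset.sum_sub_distrib, h2, sub_zero]

theorem holderTriple_renorm_two {γ : ℝ} (hγ : 1 < γ) : ENNReal.HolderTriple
    (ENNReal.ofReal (2 * γ / (γ - 1))) (ENNReal.ofReal (2 * γ)) 2 := by
  have h1 : 0 < γ - 1 := by linarith
  have h := holderTriple_ofReal (a := 2 * γ / (γ - 1)) (b := 2 * γ) (c := 2) (by positivity)
    (by positivity) (by positivity) (by field_simp; ring)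
  rwa [ofReal_two] at h

/-- The chain rule for the mollified density, tested with the velocity. The function
`ρ_ε^(γ-1) ∂ⱼρ_ε` is in `L¹ ∩ L²`, hence in the dual `L^{6/5}` of the space `L⁶` of the velocity. -/
theorem integral_rpow_transport {γ : ℝ} (hγ : 2 < γ) {k : E3 → ℝ} (hk : IsMollifier k) {ε : ℝ}
    (hε : ε ≠ 0) {ρ : E3 → ℝ} (hρm : Measurable ρ) (hρ0 : ∀ x, 0 ≤ ρ x)
    (hρ1 : MemLp ρ (ENNReal.ofReal γ) volume) (hρ2 : MemLp ρ (ENNReal.ofReal (2 * γ)) volume)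
    {φ : ℕ → E3 → ℝ} {v : E3 → ℝ} {g : Fin 3 → E3 → ℝ} (hv : IsSobolevLimit φ v g) (j : Fin 3) :
    Integrable (fun x => avg k ε ρ x ^ (γ - 1) * (v x * pd j (avg k ε ρ) x)) ∧
    γ * ∫ x, avg k ε ρ x ^ (γ - 1) * (v x * pd j (avg k ε ρ) x)
      = -∫ x, avg k ε ρ x ^ γ * g j x := by
  have hkt := hk.toIsTest
  set R := avg k ε ρ with hR
  have hloc : LocallyIntegrable ρ := hρ1.locallyIntegrable (ENNReal.one_le_ofReal.2 (by linarith))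
  have hR0 (x : E3) : 0 ≤ R x := integral_nonneg fun z => mul_nonneg (hk.nonneg z) (hρ0 _)
  have hRs : ContDiff ℝ ∞ R := contDiff_avg hkt hε hloc
  have hpd : pd j R = fun x => ε⁻¹ * avg (pd j k) ε ρ x :=
    funext fun x => pd_avg hkt hε hloc j x
  have hmem (p : ℝ) (hp : 1 ≤ p) (hρp : MemLp ρ (ENNReal.ofReal p) volume) :
      MemLp (fun x => R x ^ (γ - 1) * pd j R x) (ENNReal.ofReal (p / γ)) volume := by
    have h1 := memLp_rpow (s := γ - 1) (by linarith) (by linarith) hR0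
      (memLp_avg hkt hp ε hρm hρp)
    have h2 : MemLp (pd j R) (ENNReal.ofReal p) volume := by
      rw [hpd]; exact (memLp_avg (hkt.pd j) hp ε hρm hρp).const_mul _
    have h3 : 0 < γ - 1 := by linarith
    have := holderTriple_ofReal (a := p / (γ - 1)) (b := p) (c := p / γ) (by positivity)
      (by positivity) (by positivity) (by field_simp; ring)
    exact memLp_mul h1 h2
  have hmem65 : MemLp (fun x => R x ^ (γ - 1) * pd j R x) (ENNReal.ofReal (6 / 5)) volume := by
    have hA := hmem γ (by linarith) hρ1
    have hB := hmem (2 * γ) (by linarith) hρ2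
    rw [div_self (by linarith)] at hA
    rw [mul_div_cancel_right₀ _ (by linarith)] at hB
    exact memLp_of_memLp_of_memLp one_pos (by norm_num) (by norm_num) hA hB
  have hRγ : MemLp (fun x => R x ^ γ) 2 volume := by
    have h1 := memLp_rpow (s := γ) (by linarith) (by linarith) hR0
      (memLp_avg hkt (p := 2 * γ) (by linarith) ε hρm hρ2)
    rwa [mul_div_cancel_right₀ _ (by linarith), ofReal_two] at h1
  have hRγs : ContDiff ℝ 1 fun x => R x ^ γ :=
    (hRs.of_le (by simp)).rpow_const_of_le (by norm_num; linarith)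
  have hchain (x : E3) : pd j (fun x => R x ^ γ) x = γ * (R x ^ (γ - 1) * pd j R x) := by
    have h1 := (hRs.differentiable (by simp) x).hasFDerivAt.rpow_const (p := γ)
      (Or.inr (by linarith))
    rw [pd, h1.fderiv, pd]
    simp [mul_assoc]
  have hn (n : ℕ) : γ * ∫ x, (R x ^ (γ - 1) * pd j R x) * φ n x
      = -∫ x, R x ^ γ * pd j (φ n) x := by
    rw [(hv.test n).integral_mul_pd hRγs j, neg_neg, ← integral_const_mul]
    refine integral_congr_ae (Eventually.of_forall fun x => ?_)
    dsimp only
    rw [hchain]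
    ring
  have hl1 := ((LpTendsto.const hmem65).tendsto_integral_mul hv.tendsto).const_mul γ
  have hl2 := ((LpTendsto.const hRγ).tendsto_integral_mul (q := 2) (hv.tendsto_pd j)).neg
  simp only [hn] at hl1
  have e (x : E3) : R x ^ (γ - 1) * pd j R x * v x = R x ^ (γ - 1) * (v x * pd j R x) := by ring
  have hint := integrable_mul (p := ENNReal.ofReal (6 / 5)) (q := 6) hmem65 hv.tendsto.memLp_lim
  simp only [e] at hl1 hint
  exact ⟨hint, tendsto_nhds_unique hl1 hl2⟩

/-- The **renormalized continuity equation** in integrated form: if `div (ρu) = 0`, then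
`∫ ρ^γ div u = 0`. The commutator identity is multiplied by the power `γ - 1` of the mollified
density and integrated, and both sides are evaluated in the limit. -/
theorem sum_integral_rpow_mul_eq_zero {γ : ℝ} (hγ : 2 < γ) {ρ : E3 → ℝ} (hρm : Measurable ρ)
    (hρ0 : ∀ x, 0 ≤ ρ x) (hρ1 : MemLp ρ (ENNReal.ofReal γ) volume)
    (hρ2 : MemLp ρ (ENNReal.ofReal (2 * γ)) volume)
    {φ : Fin 3 → ℕ → E3 → ℝ} {u : Fin 3 → E3 → ℝ} {g : Fin 3 → Fin 3 → E3 → ℝ}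
    (hum : ∀ j, Measurable (u j)) (hgm : ∀ i j, Measurable (g i j))
    (hu : ∀ j, IsSobolevLimit (φ j) (u j) (g j))
    (hρu : ∀ j, LocallyIntegrable fun x => ρ x * u j x)
    (hcont : ∀ ψ, IsTest ψ → ∑ j, ∫ x, ρ x * u j x * pd j ψ x = 0) :
    ∑ j, ∫ x, ρ x ^ γ * g j j x = 0 := by
  obtain ⟨k, hk⟩ := exists_isMollifier
  have hkt := hk.toIsTest
  have hγ0 : 0 < γ := by linarith
  have hγ1 : 0 < γ - 1 := by linarith
  have hloc : LocallyIntegrable ρ := hρ1.locallyIntegrable (ENNReal.one_le_ofReal.2 (by linarith))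
  have hε : Tendsto (fun n : ℕ => 1 / ((n : ℝ) + 1)) atTop (𝓝 0) :=
    tendsto_one_div_add_atTop_nhds_zero_nat
  have hε0 : ∀ n, (fun n : ℕ => 1 / ((n : ℝ) + 1)) n ≠ 0 := fun n => by positivity
  generalize (fun n : ℕ => 1 / ((n : ℝ) + 1)) = ε at hε hε0
  set R : ℕ → E3 → ℝ := fun n => avg k (ε n) ρ with hR
  have hR0 (n : ℕ) (x : E3) : 0 ≤ R n x :=
    integral_nonneg fun z => mul_nonneg (hk.nonneg z) (hρ0 _)
  have hRm (n : ℕ) : Measurable (R n) := measurable_avg hkt _ hρm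
  have hRlim : LpTendsto (ENNReal.ofReal (2 * γ)) R ρ :=
    hk.lpTendsto_avg (by linarith) hρm hρ2 hε hε0
  have hRγ : LpTendsto 2 (fun n x => R n x ^ γ) (fun x => ρ x ^ γ) := by
    have h := hRlim.rpow (by linarith) (by linarith : 1 < γ) hR0 hρ0
    rwa [mul_div_cancel_right₀ _ hγ0.ne', ofReal_two] at h
  have hRγ1 : LpTendsto (ENNReal.ofReal (2 * γ / (γ - 1))) (fun n x => R n x ^ (γ - 1))
      (fun x => ρ x ^ (γ - 1)) :=
    hRlim.rpow (by linarith) (by linarith : 1 < γ - 1) hR0 hρ0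
  have hH := holderTriple_renorm_two (by linarith : 1 < γ)
  have hprod (z : E3) : LpTendsto 2 (fun n x => R n x ^ (γ - 1) * ρ (x - ε n • z))
      (fun x => ρ x ^ γ) := by
    have hz : Tendsto (fun n => ε n • z) atTop (𝓝 0) := by simpa using hε.smul_const z
    have h := hRγ1.mul (r := 2) (by norm_num) (lpTendsto_translate
      (ENNReal.one_le_ofReal.2 (by linarith)) ENNReal.ofReal_ne_top hρ2 hz)
    have e : (fun x => ρ x ^ (γ - 1) * ρ x) = fun x => ρ x ^ γ := by
      funext x
      rw [← Real.rpow_add_one' (hρ0 x) (by linarith), sub_add_cancel]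
    rwa [e] at h
  have hdq (j : Fin 3) (z : E3) := (hu j).lpTendsto_diffQuot (hum j) (hgm j) z hε hε0
  -- The inner integrals of the commutator after exchanging the order of integration.
  set B : Fin 3 → ℕ → E3 → ℝ := fun j n z =>
    ∫ x, R n x ^ (γ - 1) * ρ (x - ε n • z) * ((ε n)⁻¹ * (u j x - u j (x - ε n • z))) with hB
  have hBlim (j : Fin 3) (z : E3) : Tendsto (fun n => B j n z) atTop
      (𝓝 (∑ i, z i * ∫ x, ρ x ^ γ * g j i x)) := by
    have h := (hprod z).tendsto_integral_mul (q := 2) (hdq j z)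
    have e : ∫ x, ρ x ^ γ * ∑ i, z i * g j i x = ∑ i, z i * ∫ x, ρ x ^ γ * g j i x := by
      simp only [Finset.mul_sum, ← integral_const_mul]
      have hi (i : Fin 3) : Integrable fun x => ρ x ^ γ * (z i * g j i x) :=
        integrable_mul (p := 2) (q := 2) hRγ.memLp_lim
          (((hu j).tendsto_pd i).memLp_lim.const_mul (z i))
      rw [integral_finsetSum _ fun i _ => hi i]
      refine Finset.sum_congr rfl fun i _ => integral_congr_ae (Eventually.of_forall fun x => ?_)
      dsimp only
      ring
    rwa [e] at h
  obtain ⟨C₁, hC₁, hC₁'⟩ := hRγ1.exists_bound (by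
    refine ENNReal.one_le_ofReal.2 ?_
    rw [le_div_iff₀ hγ1]
    linarith)
  set C₂ := (eLpNorm ρ (ENNReal.ofReal (2 * γ)) volume).toReal with hC₂
  -- `Q j` bounds the inner integrals uniformly in `n`; it serves for Fubini's theorem and for
  -- dominated convergence in `z`.
  set Q : Fin 3 → E3 → ℝ := fun j z =>
    C₁ * C₂ * (5 * ∑ i, |z i| * (eLpNorm (g j i) 2 volume).toReal) with hQ
  have hQc (j : Fin 3) : Continuous (Q j) := by fun_prop
  have hprodMem (n : ℕ) (z : E3) : MemLp (fun x => R n x ^ (γ - 1) * ρ (x - ε n • z)) 2 volume :=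
    (hprod z).memLp n
  have hdqMem (j : Fin 3) (n : ℕ) (z : E3) :
      MemLp (fun x => (ε n)⁻¹ * (u j x - u j (x - ε n • z))) 2 volume := (hdq j z).memLp n
  have hnorm (j : Fin 3) (n : ℕ) (z : E3) :
      ∫ x, |R n x ^ (γ - 1) * ρ (x - ε n • z) * ((ε n)⁻¹ * (u j x - u j (x - ε n • z)))|
        ≤ Q j z := by
    have h1 := abs_integral_mul_le (p := 2) (q := 2) (hprodMem n z).abs (hdqMem j n z).abs
    have h2 : (eLpNorm (fun x => R n x ^ (γ - 1) * ρ (x - ε n • z)) 2 volume).toReal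
        ≤ C₁ * C₂ := by
      have h3 := ENNReal.toReal_mono (ENNReal.mul_ne_top (hRγ1.memLp n).2.ne
        (memLp_translate hρ2 (ε n • z)).2.ne)
        (eLpNorm_mul_le (r := 2) (hRγ1.memLp n).1 (memLp_translate hρ2 (ε n • z)).1)
      rw [ENNReal.toReal_mul, eLpNorm_translate hρm] at h3
      exact h3.trans (mul_le_mul_of_nonneg_right (hC₁' n) ENNReal.toReal_nonneg)
    have h4 : (eLpNorm (fun x => (ε n)⁻¹ * (u j x - u j (x - ε n • z))) 2 volume).toReal
        ≤ 5 * ∑ i, |z i| * (eLpNorm (g j i) 2 volume).toReal := by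
      have h5 := (hu j).eLpNorm_diffQuot_le (hum j) (hgm j) z (hε0 n)
      have h6 : eLpNorm (fun x => ∑ i, z i * g j i x) 2 volume
          ≤ ∑ i, ENNReal.ofReal |z i| * eLpNorm (g j i) 2 volume := by
        have e : (fun x => ∑ i, z i * g j i x) = ∑ i, z i • g j i := by
          funext x; simp
        rw [e]
        refine (eLpNorm_sum_le (fun i _ => ((hgm j i).const_smul (z i)).aestronglyMeasurable)
          (by norm_num)).trans_eq (Finset.sum_congr rfl fun i _ => ?_)
        rw [eLpNorm_const_smul, Real.enorm_eq_ofReal_abs]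
      have hfin (i : Fin 3) : ENNReal.ofReal |z i| * eLpNorm (g j i) 2 volume ≠ ⊤ :=
        ENNReal.mul_ne_top ENNReal.ofReal_ne_top ((hu j).tendsto_pd i).memLp_lim.2.ne
      have h7 := ENNReal.toReal_mono (ENNReal.mul_ne_top (by simp)
        (ENNReal.sum_ne_top.2 fun i _ => hfin i)) (h5.trans (mul_le_mul_right h6 5))
      rw [ENNReal.toReal_mul, ENNReal.toReal_sum fun i _ => hfin i] at h7
      simpa [ENNReal.toReal_mul] using h7
    simp only [abs_mul (_ * _) (_ * _)]
    refine (le_abs_self _).trans (h1.trans ?_)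
    have e1 := eLpNorm_norm (p := 2) (μ := volume) fun x => R n x ^ (γ - 1) * ρ (x - ε n • z)
    have e2 := eLpNorm_norm (p := 2) (μ := volume)
      fun x => (ε n)⁻¹ * (u j x - u j (x - ε n • z))
    refine le_of_eq_of_le (congrArg₂ (fun a b => a.toReal * b.toReal) e1 e2) ?_
    exact mul_le_mul h2 h4 ENNReal.toReal_nonneg (by positivity)
  have hBmeas (j : Fin 3) (n : ℕ) : Measurable (Function.uncurry fun (x z : E3) =>
      pd j k z * (R n x ^ (γ - 1) * ρ (x - ε n • z)
        * ((ε n)⁻¹ * (u j x - u j (x - ε n • z))))) := by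
    have hs : Measurable fun q : E3 × E3 => q.1 - ε n • q.2 :=
      measurable_fst.sub (measurable_snd.const_smul (ε n))
    exact ((hkt.pd j).continuous.measurable.comp measurable_snd).mul
      (((((hRm n).comp measurable_fst).pow_const _).mul (hρm.comp hs)).mul
        ((((hum j).comp measurable_fst).sub ((hum j).comp hs)).const_mul _))
  have hQint (j : Fin 3) : Integrable fun z => |pd j k z| * Q j z := by
    have h1 := (hkt.pd j).continuous
    have h2 : HasCompactSupport fun z => |pd j k z| := (hkt.pd j).compact.norm
    exact (h1.abs.mul (hQc j)).integrable_of_hasCompactSupport h2.mul_right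
  have hFub (j : Fin 3) (n : ℕ) : Integrable (Function.uncurry fun (x z : E3) =>
      pd j k z * (R n x ^ (γ - 1) * ρ (x - ε n • z)
        * ((ε n)⁻¹ * (u j x - u j (x - ε n • z))))) (volume.prod volume) := by
    rw [integrable_prod_iff' (hBmeas j n).aestronglyMeasurable]
    refine ⟨Eventually.of_forall fun z => ?_, ?_⟩
    · exact (integrable_mul (p := 2) (q := 2) (hprodMem n z) (hdqMem j n z)).const_mul (pd j k z)
    · refine (hQint j).mono' ?_ (Eventually.of_forall fun z => ?_)
      · exact ((hBmeas j n).norm.stronglyMeasurable.integral_prod_left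
          (f := fun x z => ‖Function.uncurry _ (x, z)‖)).aestronglyMeasurable
      · rw [Real.norm_of_nonneg (integral_nonneg fun _ => norm_nonneg _)]
        simp only [Function.uncurry, Real.norm_eq_abs, abs_mul (pd j k z)]
        rw [integral_const_mul]
        exact mul_le_mul_of_nonneg_left (hnorm j n z) (abs_nonneg _)
  have hswap (j : Fin 3) (n : ℕ) :
      ∫ x, R n x ^ (γ - 1) * ∫ z, pd j k z * (ρ (x - ε n • z)
          * ((ε n)⁻¹ * (u j x - u j (x - ε n • z)))) = ∫ z, pd j k z * B j n z := by
    simp only [hB, ← integral_const_mul]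
    rw [← integral_integral_swap (hFub j n)]
    refine integral_congr_ae (Eventually.of_forall fun x => integral_congr_ae
      (Eventually.of_forall fun z => ?_))
    dsimp only
    ring
  -- The left side comes from the chain rule, the right side from the commutator identity.
  have hid (n : ℕ) : -∑ j, ∫ x, R n x ^ γ * g j j x = γ * ∑ j, ∫ z, pd j k z * B j n z := by
    have h1 (j : Fin 3) := integral_rpow_transport hγ hk (hε0 n) hρm hρ0 hρ1 hρ2 (hu j) j
    have hI (j : Fin 3) : Integrable fun x => R n x ^ (γ - 1) * ∫ z, pd j k z * (ρ (x - ε n • z)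
          * ((ε n)⁻¹ * (u j x - u j (x - ε n • z)))) := by
      refine (hFub j n).integral_prod_left.congr (Eventually.of_forall fun x => ?_)
      simp only [Function.uncurry, ← integral_const_mul]
      refine integral_congr_ae (Eventually.of_forall fun z => ?_)
      dsimp only
      ring
    simp only [← hswap]
    rw [← Finset.sum_neg_distrib, ← integral_finsetSum _ fun j _ => hI j]
    simp only [← Finset.mul_sum]
    have h2 (x : E3) := sum_mul_pd_avg hkt (hε0 n) hloc hρu hcont x
    simp only [← h2]
    simp only [Finset.mul_sum]
    rw [integral_finsetSum _ fun j _ => (h1 j).1, Finset.mul_sum]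
    exact Finset.sum_congr rfl fun j _ => (h1 j).2.symm
  have hlimL : Tendsto (fun n => -∑ j, ∫ x, R n x ^ γ * g j j x) atTop
      (𝓝 (-∑ j, ∫ x, ρ x ^ γ * g j j x)) :=
    (tendsto_finsetSum _ fun j _ => hRγ.tendsto_integral_mul (q := 2)
      (LpTendsto.const ((hu j).tendsto_pd j).memLp_lim)).neg
  have hlimR (j : Fin 3) : Tendsto (fun n => ∫ z, pd j k z * B j n z) atTop
      (𝓝 (∫ z, pd j k z * ∑ i, z i * ∫ x, ρ x ^ γ * g j i x)) := by
    refine tendsto_integral_of_dominated_convergence (fun z => |pd j k z| * Q j z) ?_ (hQint j)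
      ?_ ?_
    · intro n
      have := (hFub j n).integral_prod_right.aestronglyMeasurable
      refine this.congr (Eventually.of_forall fun z => ?_)
      simp only [Function.uncurry, hB, integral_const_mul]
    · intro n
      refine Eventually.of_forall fun z => ?_
      rw [norm_mul]
      exact mul_le_mul_of_nonneg_left (abs_integral_le_integral_abs.trans (hnorm j n z))
        (norm_nonneg _)
    · exact Eventually.of_forall fun z => (hBlim j z).const_mul _
  have hval (j : Fin 3) : ∫ z, pd j k z * ∑ i, z i * ∫ x, ρ x ^ γ * g j i x
      = -∫ x, ρ x ^ γ * g j j x := by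
    have hi (i : Fin 3) : Integrable fun z : E3 => pd j k z * z i := by
      have hc : Continuous fun z : E3 => z i := by fun_prop
      exact ((hkt.pd j).locallyIntegrable_mul hc.locallyIntegrable).congr
        (Eventually.of_forall fun z => mul_comm _ _)
    simp only [Finset.mul_sum, ← mul_assoc]
    rw [integral_finsetSum _ fun i _ => (hi i).mul_const _]
    simp only [integral_mul_const, integral_pd_mul_coord hk]
    simp
  have hlimR' := (tendsto_finsetSum Finset.univ fun j _ => hlimR j).const_mul γ
  simp only [hval, ← hid] at hlimR'
  have h := tendsto_nhds_unique hlimL hlimR'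
  rw [Finset.sum_neg_distrib] at h
  have h' : (γ - 1) * ∑ j, ∫ x, ρ x ^ γ * g j j x = 0 := by linarith
  exact (mul_eq_zero.1 h').resolve_left hγ1.ne'

/-! ### The energy identity -/

/-- The components of Newton's viscous stress, in terms of the velocity gradient `g`. -/
def stress (μ η : ℝ) (g : Fin 3 → Fin 3 → E3 → ℝ) (i j : Fin 3) (x : E3) : ℝ :=
  viscousStress μ η (Matrix.of fun i j => g i j x) i j

theorem stress_eq (μ η : ℝ) (g : Fin 3 → Fin 3 → E3 → ℝ) (i j : Fin 3) (x : E3) :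
    stress μ η g i j x = μ * (g i j x + g j i x)
      + (if i = j then η - 2 / 3 * μ else 0) * ∑ k, g k k x := by
  simp only [stress, viscousStress, Matrix.trace, Matrix.diag, Matrix.of_apply, Matrix.add_apply,
    Matrix.smul_apply, Matrix.sub_apply, Matrix.transpose_apply, Matrix.one_apply, smul_eq_mul]
  split_ifs <;> ring

theorem memLp_stress {g : Fin 3 → Fin 3 → E3 → ℝ} (hg : ∀ i j, MemLp (g i j) 2 volume)
    (μ η : ℝ) (i j : Fin 3) : MemLp (stress μ η g i j) 2 volume := by
  have h : MemLp (fun x => μ * (g i j x + g j i x)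
      + (if i = j then η - 2 / 3 * μ else 0) * ∑ k, g k k x) 2 volume :=
    (((hg i j).add (hg j i)).const_mul μ).add
      ((memLp_finsetSum Finset.univ fun k _ => hg k k).const_mul _)
  have e : stress μ η g i j = _ := funext fun x => stress_eq μ η g i j x
  rw [e]
  exact h

/-- A velocity gradient that dissipates no energy vanishes: after integrating by parts, the
dissipation is `μ ∫ |∇u|² + (μ/3 + η) ∫ (div u)²`. -/
theorem gradient_ae_eq_zero_of_dissipation {μ η : ℝ} (hμ : 0 < μ) (hη : 0 ≤ η)
    {φ : Fin 3 → ℕ → E3 → ℝ} {u : Fin 3 → E3 → ℝ} {g : Fin 3 → Fin 3 → E3 → ℝ}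
    (hu : ∀ j, IsSobolevLimit (φ j) (u j) (g j))
    (h : ∑ i, ∑ j, ∫ x, stress μ η g i j x * g i j x = 0) (i j : Fin 3) : g i j =ᵐ[volume] 0 := by
  have hL (i j : Fin 3) : MemLp (g i j) 2 volume := ((hu i).tendsto_pd j).memLp_lim
  have hI (i j k l : Fin 3) : Integrable fun x => g i j x * g k l x :=
    integrable_mul (p := 2) (q := 2) (hL i j) (hL k l)
  have hcomm (i j : Fin 3) : ∫ x, g j i x * g i j x = ∫ x, g i i x * g j j x := by
    have h1 := ((hu j).tendsto_pd i).tendsto_integral_mul (q := 2) ((hu i).tendsto_pd j)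
    have h2 := ((hu j).tendsto_pd j).tendsto_integral_mul (q := 2) ((hu i).tendsto_pd i)
    have e (n : ℕ) := ((hu j).test n).integral_pd_mul_pd_comm ((hu i).test n) i j
    simp only [e] at h1
    rw [tendsto_nhds_unique h1 h2]
    simp only [mul_comm]
  have hI2 (i j : Fin 3) : Integrable fun x =>
      μ * (g i j x * g i j x) + μ * (g j i x * g i j x) :=
    ((hI _ _ _ _).const_mul _).add ((hI _ _ _ _).const_mul _)
  have hS (i j : Fin 3) : ∫ x, stress μ η g i j x * g i j x
      = μ * (∫ x, g i j x * g i j x) + μ * (∫ x, g i i x * g j j x)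
        + (if i = j then η - 2 / 3 * μ else 0) * ∑ k, ∫ x, g k k x * g i j x := by
    rw [← hcomm i j, ← integral_const_mul, ← integral_const_mul,
      ← integral_finsetSum _ fun k _ => hI k k i j, ← integral_const_mul,
      ← integral_add ((hI _ _ _ _).const_mul _) ((hI _ _ _ _).const_mul _),
      ← integral_add (hI2 i j)
        ((integrable_finsetSum _ fun k _ => hI k k i j).const_mul _)]
    refine integral_congr_ae (Eventually.of_forall fun x => ?_)
    dsimp only
    rw [stress_eq, ← Finset.sum_mul]
    ring
  have hdiv : ∑ i, ∑ j, ∫ x, g i i x * g j j x = ∫ x, (∑ i, g i i x) * ∑ j, g j j x := by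
    simp only [Finset.sum_mul_sum]
    rw [integral_finsetSum _ fun i _ => integrable_finsetSum _ fun j _ => hI i i j j]
    exact Finset.sum_congr rfl fun i _ => (integral_finsetSum _ fun j _ => hI i i j j).symm
  have hdiv0 : 0 ≤ ∑ i, ∑ j, ∫ x, g i i x * g j j x := by
    rw [hdiv]
    exact integral_nonneg fun x => mul_self_nonneg _
  have hnn (i j : Fin 3) : 0 ≤ ∫ x, g i j x * g i j x := integral_nonneg fun x => mul_self_nonneg _
  have htotal : μ * (∑ i, ∑ j, ∫ x, g i j x * g i j x)
      + (μ / 3 + η) * ∑ i, ∑ j, ∫ x, g i i x * g j j x = 0 := by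
    rw [← h]
    simp only [hS]
    simp only [Fin.sum_univ_three]
    simp
    ring
  have hzero : ∑ i, ∑ j, ∫ x, g i j x * g i j x = 0 := by
    have h1 : 0 ≤ ∑ i, ∑ j, ∫ x, g i j x * g i j x :=
      Finset.sum_nonneg fun i _ => Finset.sum_nonneg fun j _ => hnn i j
    have h2 : 0 ≤ (μ / 3 + η) * ∑ i, ∑ j, ∫ x, g i i x * g j j x := mul_nonneg (by positivity) hdiv0
    have h3 : μ * (∑ i, ∑ j, ∫ x, g i j x * g i j x) = 0 := by
      have := mul_nonneg hμ.le h1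
      linarith
    exact (mul_eq_zero.1 h3).resolve_left hμ.ne'
  have h4 := (Finset.sum_eq_zero_iff_of_nonneg fun i _ =>
    Finset.sum_nonneg fun j _ => hnn i j).1 hzero i (Finset.mem_univ i)
  have h5 := (Finset.sum_eq_zero_iff_of_nonneg fun j _ => hnn i j).1 h4 j (Finset.mem_univ j)
  rw [integral_eq_zero_iff_of_nonneg (fun x => mul_self_nonneg _) (hI i j i j)] at h5
  filter_upwards [h5] with x hx
  exact mul_self_eq_zero.1 hx

/-- The pointwise bound behind `ρu ∈ L³`. -/
theorem mul_pow_three_le {γ r t : ℝ} (hγ : 6 ≤ γ) (hr : 0 ≤ r) (ht : 0 ≤ t) :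
    (r * t) ^ 3 ≤ r * t ^ 2 + r ^ γ + t ^ 6 := by
  have h1 : 0 ≤ r ^ γ := Real.rpow_nonneg hr γ
  have h2 : 0 ≤ r * t ^ 2 := by positivity
  have h3 : 0 ≤ t ^ 6 := by positivity
  rcases le_or_gt (r ^ 2 * t) 1 with h | h
  · have : (r * t) ^ 3 = r * t ^ 2 * (r ^ 2 * t) := by ring
    have := mul_le_mul_of_nonneg_left h h2
    linarith
  rcases le_or_gt r t with h' | h'
  · have : (r * t) ^ 3 ≤ (t * t) ^ 3 := by gcongr
    have : (t * t) ^ 3 = t ^ 6 := by ring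
    linarith
  · have hr1 : 1 ≤ r := by
      by_contra hlt
      push Not at hlt
      have h4 : r ^ 2 * t ≤ 1 * 1 :=
        mul_le_mul (pow_le_one₀ hr hlt.le) (h'.le.trans hlt.le) ht zero_le_one
      linarith
    have h5 : (r * t) ^ 3 ≤ (r * r) ^ 3 := by gcongr
    have h6 : (r * r) ^ 3 = r ^ (6 : ℝ) := by
      rw [show (6 : ℝ) = ((6 : ℕ) : ℝ) by norm_num, Real.rpow_natCast]
      ring
    have h7 : r ^ (6 : ℝ) ≤ r ^ γ := Real.rpow_le_rpow_of_exponent_le hr1 hγ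
    exact (h5.trans (h6.trans_le h7)).trans (by linarith)

theorem memLp_of_integrable_rpow {p : ℝ} (hp : 0 < p) {f : E3 → ℝ} (hfm : Measurable f)
    (hf0 : ∀ x, 0 ≤ f x) (hf : Integrable fun x => f x ^ p) :
    MemLp f (ENNReal.ofReal p) volume := by
  rw [memLp_ofReal_iff hp hfm.aestronglyMeasurable]
  simpa only [abs_of_nonneg (hf0 _)] using hf

/-- The momentum of a finite energy flow with square integrable velocity gradient is in `L³`. -/
theorem memLp_three_momentum {γ : ℝ} (hγ : 6 ≤ γ) {ρ v : E3 → ℝ} (hρm : Measurable ρ)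
    (hρ0 : ∀ x, 0 ≤ ρ x) (hvm : Measurable v) (hv : MemLp v 6 volume)
    (hE1 : Integrable fun x => ρ x * v x ^ 2) (hE2 : Integrable fun x => ρ x ^ γ) :
    MemLp (fun x => ρ x * v x) 3 volume := by
  have h3 : ENNReal.ofReal 3 = 3 := by simp
  have h6 : ENNReal.ofReal 6 = 6 := by simp
  have hm : Measurable fun x => ρ x * v x := hρm.mul hvm
  rw [← h3, memLp_ofReal_iff (by norm_num) hm.aestronglyMeasurable]
  rw [← h6, memLp_ofReal_iff (by norm_num) hvm.aestronglyMeasurable] at hv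
  refine ((hE1.add hE2).add hv).mono' (hm.abs.pow_const _).aestronglyMeasurable
    (Eventually.of_forall fun x => ?_)
  have h := mul_pow_three_le hγ (hρ0 x) (abs_nonneg (v x))
  rw [Real.norm_of_nonneg (Real.rpow_nonneg (abs_nonneg _) _), abs_mul, abs_of_nonneg (hρ0 x)]
  rw [show (3 : ℝ) = ((3 : ℕ) : ℝ) by norm_num, Real.rpow_natCast]
  dsimp only [Pi.add_apply]
  rw [show (6 : ℝ) = ((6 : ℕ) : ℝ) by norm_num, Real.rpow_natCast]
  simpa only [sq_abs] using h

theorem holderTriple_two_six : ENNReal.HolderTriple 6 2 (ENNReal.ofReal (3 / 2)) := by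
  have h := holderTriple_ofReal (a := 6) (b := 2) (c := 3 / 2) (by norm_num) (by norm_num)
    (by norm_num) (by norm_num)
  simpa using h

theorem holderTriple_three_six : ENNReal.HolderTriple 3 6 2 := by
  have h := holderTriple_ofReal (a := 3) (b := 6) (c := 2) (by norm_num) (by norm_num)
    (by norm_num) (by norm_num)
  simpa using h

theorem holderConjugate_three : ENNReal.HolderConjugate 3 (ENNReal.ofReal (3 / 2)) := by
  have h := holderTriple_ofReal (a := 3) (b := 3 / 2) (c := 1) (by norm_num) (by norm_num)
    (by norm_num) (by norm_num)
  simpa using h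

/-- The continuity equation tested with `|u|²`: convection does no work. -/
theorem sum_integral_convection_eq_zero {ρ : E3 → ℝ}
    {φ : Fin 3 → ℕ → E3 → ℝ} {u : Fin 3 → E3 → ℝ} {g : Fin 3 → Fin 3 → E3 → ℝ}
    (hu : ∀ j, IsSobolevLimit (φ j) (u j) (g j))
    (hρu : ∀ j, MemLp (fun x => ρ x * u j x) 3 volume)
    (hcont : ∀ ψ, IsTest ψ → ∑ j, ∫ x, ρ x * u j x * pd j ψ x = 0) :
    ∑ i, ∑ j, ∫ x, ρ x * u i x * u j x * g i j x = 0 := by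
  have hH := holderTriple_two_six
  have hC := holderConjugate_three
  refine Finset.sum_eq_zero fun i _ => ?_
  have h1 (j : Fin 3) := (LpTendsto.const (hρu j)).tendsto_integral_mul
    ((hu i).tendsto.mul (r := ENNReal.ofReal (3 / 2)) (ENNReal.one_le_ofReal.2 (by norm_num))
      ((hu i).tendsto_pd j))
  have h2 := tendsto_finsetSum Finset.univ fun j _ => h1 j
  have h3 (n : ℕ) : ∑ j, ∫ x, ρ x * u j x * (φ i n x * pd j (φ i n) x) = 0 := by
    have ht := (hu i).test n
    have h4 := hcont _ (ht.mul ht)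
    have h5 (j : Fin 3) : ∫ x, ρ x * u j x * pd j (fun x => φ i n x * φ i n x) x
        = 2 * ∫ x, ρ x * u j x * (φ i n x * pd j (φ i n) x) := by
      rw [← integral_const_mul]
      refine integral_congr_ae (Eventually.of_forall fun x => ?_)
      dsimp only
      rw [pd_mul (ht.differentiable x) (ht.differentiable x)]
      ring
    simp only [h5, ← Finset.mul_sum] at h4
    exact (mul_eq_zero.1 h4).resolve_left two_ne_zero
  simp only [h3] at h2
  rw [tendsto_nhds_unique tendsto_const_nhds h2]
  refine Finset.sum_congr rfl fun j _ => integral_congr_ae (Eventually.of_forall fun x => ?_)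
  dsimp only
  ring

/-- A potential force does no work on a steady flow: `ρu` is in the dual of `L^q`, so the continuity
equation may be tested with the potential. -/
theorem sum_integral_force_eq_zero {γ : ℝ} (hγ : 6 ≤ γ) {ρ : E3 → ℝ} {u F : Fin 3 → E3 → ℝ}
    {ψ : ℕ → E3 → ℝ} (hρ : MemLp ρ (ENNReal.ofReal γ) volume) (hu : ∀ j, MemLp (u j) 6 volume)
    (hψ : ∀ n, IsTest (ψ n))
    (hF : ∀ j, LpTendsto (ENNReal.ofReal (6 * γ / (5 * γ - 6))) (fun n => pd j (ψ n)) (F j))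
    (hcont : ∀ ψ, IsTest ψ → ∑ j, ∫ x, ρ x * u j x * pd j ψ x = 0) :
    ∑ j, ∫ x, ρ x * F j x * u j x = 0 := by
  have h5 : 0 < 5 * γ - 6 := by linarith
  have hH := holderTriple_ofReal (a := γ) (b := 6) (c := 6 * γ / (γ + 6)) (by linarith)
    (by norm_num) (by positivity) (by field_simp; ring)
  have hC := holderTriple_ofReal (a := 6 * γ / (γ + 6)) (b := 6 * γ / (5 * γ - 6)) (c := 1)
    (by positivity) (div_pos (by linarith) h5) one_pos (by field_simp; ring)
  rw [ENNReal.ofReal_one] at hC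
  rw [ENNReal.ofReal_ofNat] at hH
  have h1 (j : Fin 3) := (LpTendsto.const (memLp_mul (r := ENNReal.ofReal (6 * γ / (γ + 6))) hρ
    (hu j))).tendsto_integral_mul (hF j)
  have h2 := tendsto_finsetSum Finset.univ fun j _ => h1 j
  simp only [hcont _ (hψ _)] at h2
  rw [tendsto_nhds_unique tendsto_const_nhds h2]
  refine Finset.sum_congr rfl fun j _ => integral_congr_ae (Eventually.of_forall fun x => ?_)
  dsimp only
  ring

/-- The velocity gradient `g` of a finite energy solution vanishes. The equations are written in
components, for a density that is nonnegative everywhere and for measurable representatives. -/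
theorem gradient_ae_eq_zero {γ μ η : ℝ} (hγ : 6 ≤ γ) (hμ : 0 < μ) (hη : 0 ≤ η)
    {ρ : E3 → ℝ} (hρm : Measurable ρ) (hρ0 : ∀ x, 0 ≤ ρ x)
    {φ : Fin 3 → ℕ → E3 → ℝ} {u : Fin 3 → E3 → ℝ} {g : Fin 3 → Fin 3 → E3 → ℝ}
    (hum : ∀ j, Measurable (u j)) (hgm : ∀ i j, Measurable (g i j))
    (hu : ∀ j, IsSobolevLimit (φ j) (u j) (g j))
    {F : Fin 3 → E3 → ℝ} {ψ : ℕ → E3 → ℝ} (hψ : ∀ n, IsTest (ψ n))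
    (hF : ∀ j, LpTendsto (ENNReal.ofReal (6 * γ / (5 * γ - 6))) (fun n => pd j (ψ n)) (F j))
    (hE1 : ∀ i, Integrable fun x => ρ x * u i x ^ 2) (hE2 : Integrable fun x => ρ x ^ γ)
    (hcont : ∀ ψ, IsTest ψ → ∑ j, ∫ x, ρ x * u j x * pd j ψ x = 0)
    (hmom : ∀ w : Fin 3 → E3 → ℝ, (∀ i, IsTest (w i)) →
      (∑ i, ∑ j, ∫ x, ρ x * u i x * u j x * pd j (w i) x) + ∑ i, ∫ x, ρ x ^ γ * pd i (w i) x
        = (∑ i, ∑ j, ∫ x, stress μ η g i j x * pd j (w i) x) - ∑ i, ∫ x, ρ x * F i x * w i x)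
    (i j : Fin 3) : g i j =ᵐ[volume] 0 := by
  have hγ0 : 0 < γ := by linarith
  have h5 : 0 < 5 * γ - 6 := by linarith
  have hu6 (i : Fin 3) : MemLp (u i) 6 volume := (hu i).tendsto.memLp_lim
  have hg2 (i j : Fin 3) : MemLp (g i j) 2 volume := ((hu i).tendsto_pd j).memLp_lim
  have hρ1 : MemLp ρ (ENNReal.ofReal γ) volume := memLp_of_integrable_rpow hγ0 hρm hρ0 hE2
  have hρu (i : Fin 3) : MemLp (fun x => ρ x * u i x) 3 volume :=
    memLp_three_momentum hγ hρm hρ0 (hum i) (hu6 i) (hE1 i) hE2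
  have hH := holderTriple_three_six
  have hρuu (i j : Fin 3) : MemLp (fun x => ρ x * u i x * u j x) 2 volume :=
    memLp_mul (p := 3) (q := 6) (hρu i) (hu6 j)
  have hH' := holderTriple_ofReal (a := γ) (b := 6 * γ / (5 * γ - 6)) (c := 6 / 5) hγ0
    (by positivity) (by norm_num) (by field_simp; ring)
  have hρF (i : Fin 3) : MemLp (fun x => ρ x * F i x) (ENNReal.ofReal (6 / 5)) volume :=
    memLp_mul hρ1 (hF i).memLp_lim
  have hS (i j : Fin 3) := memLp_stress hg2 μ η i j
  have hPm : Measurable fun x => ρ x ^ γ := hρm.pow_const γ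
  have hP2 : MemLp (fun x => ρ x ^ γ) 2 volume := by
    refine memLp_two_of_gradient hPm hE2
      (A := fun i j x => stress μ η g i j x - ρ x * u i x * u j x)
      (fun i j => (hS i j).sub (hρuu i j)) (b := fun i x => -1 * (ρ x * F i x))
      (fun i => (hρF i).const_mul (-1)) fun χ hχ => ?_
    -- The momentum equation tested with the gradient field `∇χ`.
    have h := hmom (fun i => pd i χ) fun i => hχ.pd i
    have h22 (i j : Fin 3) := ((hχ.pd i).pd j).memLp 2
    have e1 : ∫ x, ρ x ^ γ * lap χ x = ∑ i, ∫ x, ρ x ^ γ * pd i (pd i χ) x := by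
      simp only [lap, Finset.mul_sum]
      exact integral_finsetSum _ fun i _ => ((hχ.pd i).pd i).integrable_mul hE2
    have e2 (i j : Fin 3) : ∫ x, (stress μ η g i j x - ρ x * u i x * u j x) * pd j (pd i χ) x
        = (∫ x, stress μ η g i j x * pd j (pd i χ) x)
          - ∫ x, ρ x * u i x * u j x * pd j (pd i χ) x := by
      rw [← integral_sub (BarotropicNS.integrable_mul (p := 2) (q := 2) (hS i j) (h22 i j))
        (BarotropicNS.integrable_mul (p := 2) (q := 2) (hρuu i j) (h22 i j))]
      simp only [sub_mul]
    have e3 (i : Fin 3) : ∫ x, -1 * (ρ x * F i x) * pd i χ x = -∫ x, ρ x * F i x * pd i χ x := by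
      rw [← integral_neg]
      simp only [neg_mul, one_mul]
    simp only [e1, e2, e3, Finset.sum_sub_distrib, Finset.sum_neg_distrib]
    linarith
  have hρ2 : MemLp ρ (ENNReal.ofReal (2 * γ)) volume := by
    refine memLp_of_integrable_rpow (by positivity) hρm hρ0 ?_
    refine (BarotropicNS.integrable_mul (p := 2) (q := 2) hP2 hP2).congr
      (Eventually.of_forall fun x => ?_)
    dsimp only
    rw [← Real.rpow_add_of_nonneg (hρ0 x) hγ0.le hγ0.le, two_mul]
  have hdiv := sum_integral_rpow_mul_eq_zero (by linarith) hρm hρ0 hρ1 hρ2 hum hgm hu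
    (fun j => (hρu j).locallyIntegrable (by norm_num)) hcont
  have hconv := sum_integral_convection_eq_zero hu hρu hcont
  have hforce := sum_integral_force_eq_zero hγ hρ1 hu6 hψ hF hcont
  -- The momentum equation extends by density from test fields to the velocity itself.
  have hlim {A : Fin 3 → Fin 3 → E3 → ℝ} (hA : ∀ i j, MemLp (A i j) 2 volume) :
      Tendsto (fun n => ∑ i, ∑ j, ∫ x, A i j x * pd j (φ i n) x) atTop
        (𝓝 (∑ i, ∑ j, ∫ x, A i j x * g i j x)) :=
    tendsto_finsetSum _ fun i _ => tendsto_finsetSum _ fun j _ =>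
      (LpTendsto.const (hA i j)).tendsto_integral_mul (q := 2) ((hu i).tendsto_pd j)
  have hlimP : Tendsto (fun n => ∑ i, ∫ x, ρ x ^ γ * pd i (φ i n) x) atTop
      (𝓝 (∑ i, ∫ x, ρ x ^ γ * g i i x)) :=
    tendsto_finsetSum _ fun i _ =>
      (LpTendsto.const hP2).tendsto_integral_mul (q := 2) ((hu i).tendsto_pd i)
  have hlimF : Tendsto (fun n => ∑ i, ∫ x, ρ x * F i x * φ i n x) atTop
      (𝓝 (∑ i, ∫ x, ρ x * F i x * u i x)) :=
    tendsto_finsetSum _ fun i _ =>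
      (LpTendsto.const (hρF i)).tendsto_integral_mul (q := 6) (hu i).tendsto
  have hL := (hlim hρuu).add hlimP
  simp only [hmom _ fun i => (hu i).test _] at hL
  have hfinal := tendsto_nhds_unique hL ((hlim hS).sub hlimF)
  rw [hconv, hdiv, hforce, add_zero, sub_zero] at hfinal
  exact gradient_ae_eq_zero_of_dissipation hμ hη hu hfinal.symm i j


/-! ### From weak solutions to the scalar form of the equations -/

theorem integrable_apply_mul {f : E3 → E3} (hf : LocallyIntegrable f) {φ : E3 → ℝ}
    (hφ : IsTest φ) (j : Fin 3) : Integrable fun x => f x j * φ x := by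
  have h := (EuclideanSpace.proj (𝕜 := ℝ) j).integrable_comp
    (hf.integrable_smul_left_of_hasCompactSupport hφ.continuous hφ.compact)
  simpa [mul_comm] using h

theorem inner_eq_sum (a b : E3) : inner ℝ a b = ∑ i, a i * b i := by
  simp [PiLp.inner_apply, mul_comm]

/-- A finite energy makes the kinetic energy of each component and the pressure integrable. -/
theorem integrable_of_energy {γ : ℝ} (hγ : 1 < γ) {ρ : E3 → ℝ} {u : E3 → E3}
    (hρm : AEMeasurable ρ) (hum : AEMeasurable u) (hρ : ∀ᵐ x, 0 ≤ ρ x)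
    (h : Integrable fun x => (1 / 2) * ρ x * ‖u x‖ ^ 2 + 1 / (γ - 1) * ρ x ^ γ) :
    (∀ i, Integrable fun x => ρ x * u x i ^ 2) ∧ Integrable fun x => ρ x ^ γ := by
  have hγ' : 0 < γ - 1 := by linarith
  have hi (i : Fin 3) : AEMeasurable fun x => u x i :=
    (EuclideanSpace.proj (𝕜 := ℝ) i).continuous.measurable.comp_aemeasurable hum
  constructor
  · intro i
    refine (h.const_mul 2).mono' (hρm.mul ((hi i).pow_const 2)).aestronglyMeasurable ?_
    filter_upwards [hρ] with x hx
    have h1 : u x i ^ 2 ≤ ‖u x‖ ^ 2 := by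
      rw [EuclideanSpace.real_norm_sq_eq]
      exact Finset.single_le_sum (f := fun i => u x i ^ 2) (fun i _ => sq_nonneg _)
        (Finset.mem_univ i)
    have h2 : 0 ≤ 1 / (γ - 1) * ρ x ^ γ := by positivity
    rw [Real.norm_of_nonneg (by positivity)]
    linarith [mul_le_mul_of_nonneg_left h1 hx]
  · refine (h.const_mul (γ - 1)).mono' (hρm.pow_const γ).aestronglyMeasurable ?_
    filter_upwards [hρ] with x hx
    have h2 : 0 ≤ (γ - 1) * ((1 / 2) * ρ x * ‖u x‖ ^ 2) := by positivity
    rw [Real.norm_of_nonneg (by positivity), mul_add, ← mul_assoc (γ - 1) (1 / (γ - 1)),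
      mul_one_div_cancel hγ'.ne', one_mul]
    linarith

theorem integrable_mul_apply_mul_apply {ρ : E3 → ℝ} {u : E3 → E3}
    (hρm : AEMeasurable ρ) (hum : AEMeasurable u) (hρ : ∀ᵐ x, 0 ≤ ρ x)
    (h : ∀ i, Integrable fun x => ρ x * u x i ^ 2) (i j : Fin 3) :
    Integrable fun x => ρ x * u x i * u x j := by
  have hi (i : Fin 3) : AEMeasurable fun x => u x i :=
    (EuclideanSpace.proj (𝕜 := ℝ) i).continuous.measurable.comp_aemeasurable hum
  refine ((h i).add (h j)).mono' ((hρm.mul (hi i)).mul (hi j)).aestronglyMeasurable ?_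
  filter_upwards [hρ] with x hx
  have h1 : |u x i * u x j| ≤ u x i ^ 2 + u x j ^ 2 := by
    rw [abs_le]
    constructor <;> nlinarith [sq_nonneg (u x i + u x j), sq_nonneg (u x i - u x j)]
  rw [Real.norm_eq_abs, mul_assoc, abs_mul, abs_of_nonneg hx, Pi.add_apply, ← mul_add]
  exact mul_le_mul_of_nonneg_left h1 hx

namespace IsWeakSolution

variable {p : ℝ → ℝ} {μ η : ℝ} {G ρ : E3 → ℝ} {u : E3 → E3}

theorem sum_integral_momentum_mul_pd (h : IsWeakSolution p μ η G ρ u) {ψ : E3 → ℝ}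
    (hψ : IsTest ψ) : ∑ j, ∫ x, ρ x * u x j * pd j ψ x = 0 := by
  have h1 := h.continuity_eq ψ hψ.smooth hψ.compact
  simp only [inner_eq_sum, gradient_apply] at h1
  rw [integral_finsetSum _ fun j _ =>
    integrable_apply_mul h.locallyIntegrable_momentum (hψ.pd j) j] at h1
  exact h1

theorem sum_integral_momentum_eq (h : IsWeakSolution p μ η G ρ u)
    (hP : Integrable fun x => p (ρ x)) (hE : ∀ i j, Integrable fun x => ρ x * u x i * u x j)
    (hg : ∀ i j, MemLp (fun x => weakGradient (fun y => u y i) x j) 2 volume)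
    {w : Fin 3 → E3 → ℝ} (hw : ∀ i, IsTest (w i)) :
    (∑ i, ∑ j, ∫ x, ρ x * u x i * u x j * pd j (w i) x) + ∑ i, ∫ x, p (ρ x) * pd i (w i) x
      = (∑ i, ∑ j, ∫ x, stress μ η (fun i j x => weakGradient (fun y => u y i) x j) i j x
            * pd j (w i) x)
        - ∑ i, ∫ x, ρ x * weakGradient G x i * w i x := by
  let W : E3 → E3 := fun x => WithLp.toLp 2 fun i => w i x
  have hWs : ContDiff ℝ 1 W :=
    (contDiff_euclidean (𝕜 := ℝ)).2 fun i => (hw i).smooth.of_le (by norm_cast)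
  have hWc : HasCompactSupport W := by
    refine HasCompactSupport.of_support_subset_isCompact
      (K := ⋃ i, tsupport (w i)) (isCompact_iUnion fun i => (hw i).compact) fun x hx => ?_
    by_contra hx'
    simp only [Set.mem_iUnion, not_exists] at hx'
    refine hx ?_
    ext i
    exact image_eq_zero_of_notMem_tsupport (f := w i) (hx' i)
  have hJ (x : E3) (i j : Fin 3) : jacobian W x i j = pd j (w i) x := gradient_apply _ _ _
  have hS (i j : Fin 3) : Integrable fun x =>
      stress μ η (fun i j x => weakGradient (fun y => u y i) x j) i j x * pd j (w i) x :=
    BarotropicNS.integrable_mul (p := 2) (q := 2) (memLp_stress hg μ η i j)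
      (((hw i).pd j).memLp 2)
  have h1 := h.momentum_eq W hWs hWc
  have e1 (x : E3) : ρ x * contract (Matrix.vecMulVec (u x) (u x)) (jacobian W x)
      + p (ρ x) * (jacobian W x).trace
      = (∑ i, ∑ j, ρ x * u x i * u x j * pd j (w i) x) + ∑ i, p (ρ x) * pd i (w i) x := by
    simp only [contract, Matrix.vecMulVec_apply, hJ, Matrix.trace, Matrix.diag_apply,
      Finset.mul_sum, mul_assoc]
  have e2 (x : E3) : contract (viscousStress μ η (weakJacobian u x)) (jacobian W x)
      = ∑ i, ∑ j, stress μ η (fun i j x => weakGradient (fun y => u y i) x j) i j x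
          * pd j (w i) x := by
    simp only [contract, hJ, stress, weakJacobian]
  have e3 (x : E3) : inner ℝ (ρ x • weakGradient G x) (W x)
      = ∑ i, ρ x * weakGradient G x i * w i x := inner_eq_sum _ _
  have hEw (i j : Fin 3) := ((hw i).pd j).integrable_mul (hE i j)
  have hPw (i : Fin 3) := ((hw i).pd i).integrable_mul hP
  have hFw (i : Fin 3) : Integrable fun x => ρ x * weakGradient G x i * w i x :=
    integrable_apply_mul h.locallyIntegrable_force (hw i) i
  simp only [e1, e2, e3] at h1
  rw [integral_add (integrable_finsetSum _ fun i _ => integrable_finsetSum _ fun j _ => hEw i j)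
      (integrable_finsetSum _ fun i _ => hPw i),
    integral_finsetSum _ fun i _ => integrable_finsetSum _ fun j _ => hEw i j,
    integral_finsetSum _ fun i _ => hPw i,
    integral_finsetSum _ fun i _ => integrable_finsetSum _ fun j _ => hS i j,
    integral_finsetSum _ fun i _ => hFw i] at h1
  simpa only [integral_finsetSum _ fun j _ => hEw _ j, integral_finsetSum _ fun j _ => hS _ j]
    using h1

/-- The velocity of a finite energy solution vanishes. The solution is replaced by measurable
representatives, with a density that is nonnegative everywhere. -/
theorem velocity_ae_eq_zero {γ : ℝ} (hγ : 6 ≤ γ) (hμ : 0 < μ) (hη : 0 ≤ η)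
    (hG : MemD01 (ENNReal.ofReal (6 * γ / (5 * γ - 6))) G)
    (h : IsWeakSolution (fun r : ℝ => r ^ γ) μ η G ρ u)
    (henergy : Integrable fun x => (1 / 2) * ρ x * ‖u x‖ ^ 2 + 1 / (γ - 1) * ρ x ^ γ) :
    u =ᵐ[volume] 0 := by
  obtain ⟨hE, hP⟩ := integrable_of_energy (by linarith) h.aemeasurable_density
    h.aemeasurable_velocity h.density_nonneg henergy
  have hEij := integrable_mul_apply_mul_apply h.aemeasurable_density h.aemeasurable_velocity
    h.density_nonneg hE
  obtain ⟨ψ, hψ, hF, -⟩ := pd_weakGradient_lpTendsto hG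
  choose φ hφ using fun i => exists_isSobolevLimit (h.velocity_mem i)
  have hg2 (i j : Fin 3) : MemLp (fun x => weakGradient (fun y => u y i) x j) 2 volume :=
    ((hφ i).tendsto_pd j).memLp_lim
  let ρ' : E3 → ℝ := fun x => max (h.aemeasurable_density.mk ρ x) 0
  have hρ' : ρ =ᵐ[volume] ρ' := by
    filter_upwards [h.aemeasurable_density.ae_eq_mk, h.density_nonneg] with x h1 h2
    rw [h1] at h2
    exact h1.trans (max_eq_left h2).symm
  let v : Fin 3 → E3 → ℝ := fun i x => h.aemeasurable_velocity.mk u x i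
  have hv (i : Fin 3) : (fun x => u x i) =ᵐ[volume] v i := by
    filter_upwards [h.aemeasurable_velocity.ae_eq_mk] with x h1
    rw [h1]
  have hvm (i : Fin 3) : Measurable (v i) :=
    (EuclideanSpace.proj (𝕜 := ℝ) i).continuous.measurable.comp
      h.aemeasurable_velocity.measurable_mk
  let g : Fin 3 → Fin 3 → E3 → ℝ := fun i j => (hg2 i j).1.mk _
  have hg (i j : Fin 3) : (fun x => weakGradient (fun y => u y i) x j) =ᵐ[volume] g i j :=
    (hg2 i j).1.ae_eq_mk
  have hstress (i j : Fin 3) : stress μ η (fun i j x => weakGradient (fun y => u y i) x j) i j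
      =ᵐ[volume] stress μ η g i j := by
    have hall : ∀ᵐ x, ∀ k l, weakGradient (fun y => u y k) x l = g k l x :=
      ae_all_iff.2 fun k => ae_all_iff.2 fun l => hg k l
    filter_upwards [hall] with x hx
    simp only [stress, hx]
  have hlim (i : Fin 3) : IsSobolevLimit (φ i) (v i) (g i) := (hφ i).congr_lim (hv i) (hg i)
  have hzero := gradient_ae_eq_zero hγ hμ hη (ρ := ρ')
    (h.aemeasurable_density.measurable_mk.max measurable_const) (fun x => le_max_right _ _)
    hvm (fun i j => (hg2 i j).1.stronglyMeasurable_mk.measurable) hlim hψ hF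
    (fun i => (hE i).congr <| by
      filter_upwards [hρ', hv i] with x h1 h2
      rw [h1, h2])
    (hP.congr <| by
      filter_upwards [hρ'] with x h1
      rw [h1])
    (fun χ hχ => by
      rw [← h.sum_integral_momentum_mul_pd hχ]
      refine Finset.sum_congr rfl fun j _ => integral_congr_ae ?_
      filter_upwards [hρ', hv j] with x h1 h2
      rw [h1, h2])
    (fun w hw => by
      have key := h.sum_integral_momentum_eq hP hEij hg2 hw
      have e1 (i j : Fin 3) : ∫ x, ρ x * u x i * u x j * pd j (w i) x
          = ∫ x, ρ' x * v i x * v j x * pd j (w i) x := by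
        refine integral_congr_ae ?_
        filter_upwards [hρ', hv i, hv j] with x h1 h2 h3
        rw [h1, h2, h3]
      have e2 (i : Fin 3) : ∫ x, ρ x ^ γ * pd i (w i) x = ∫ x, ρ' x ^ γ * pd i (w i) x := by
        refine integral_congr_ae ?_
        filter_upwards [hρ'] with x h1
        rw [h1]
      have e3 (i j : Fin 3) :
          ∫ x, stress μ η (fun i j x => weakGradient (fun y => u y i) x j) i j x * pd j (w i) x
            = ∫ x, stress μ η g i j x * pd j (w i) x := by
        refine integral_congr_ae ?_
        filter_upwards [hstress i j] with x h1
        rw [h1]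
      have e4 (i : Fin 3) : ∫ x, ρ x * weakGradient G x i * w i x
          = ∫ x, ρ' x * weakGradient G x i * w i x := by
        refine integral_congr_ae ?_
        filter_upwards [hρ'] with x h1
        rw [h1]
      simpa only [e1, e2, e3, e4] using key)
  have hu0 : ∀ᵐ x, ∀ i, u x i = 0 :=
    ae_all_iff.2 fun i => (hv i).trans ((hlim i).ae_eq_zero (hzero i))
  filter_upwards [hu0] with x hx
  ext i
  exact hx i

end IsWeakSolution

end BarotropicNS

end

theorem theorem6 (γ μ η : ℝ) (hγ : 6 ≤ γ) (hμ : 0 < μ) (hη : 0 ≤ η)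
    (G ρ : BarotropicNS.E3 → ℝ) (u : BarotropicNS.E3 → BarotropicNS.E3)
    (hG : BarotropicNS.MemD01 (ENNReal.ofReal (6 * γ / (5 * γ - 6))) G)
    (hsol : BarotropicNS.IsWeakSolution (fun r : ℝ => r ^ γ) μ η G ρ u)
    (henergy : Integrable
      (fun x => (1 / 2) * ρ x * ‖u x‖ ^ 2 + 1 / (γ - 1) * ρ x ^ γ) volume) :
    u =ᵐ[volume] 0 :=
  hsol.velocity_ae_eq_zero hγ hμ hη hG henergy
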